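/- Let $d,k\ge 1$, and let $\gamma:[0,1]\to\mathbb R^d$ be a path of length $1$ that is $C^{k+1}$ on $[0,1]$ and is at natural parametrization, that is, $|\dot\gamma(t)|=1$. Put $\theta=\dot\gamma$ and $P(t)=I+\theta(t)\theta(t)^T$, and define $$A_1(t)=-P(t)^{-1}\theta'(t),\qquad A_{n+1}(t)=-P(t)^{-1}\Big(A_n'(t)+\sum_{j=1}^{n}A_j(t)\,\theta(t)^T A_{n+1-j}(t)\Big)\quad(1\le n\le k-1),$$ and $A_0=\theta$ (derivatives at $t=0,1$ are one-sided). For $\lambda>0$ let $\Gamma_\lambda$ be the Cartan development of $\lambda\gamma$, that is, the $(d+1)\times(d+1)$ matrix solution of $$\Gamma_\lambda'(t)=F(\lambda\theta(t))\,\Gamma_\lambda(t),\quad \Gamma_\lambda(0)=I,\qquad F(x)=\begin{pmatrix}0&x\\x^T&0\end{pmatrix},$$ and write $\Gamma_\lambda(t)\,(0,\dots,0,1)^T=\big(\eta_\lambda(t)\sinh\rho_\lambda(t),\ \cosh\rho_\lambda(t)\big)^T$ with $|\eta_\lambda(t)|=1$, $\rho_\lambda(t)\ge 0$, and with the convention $\eta_\lambda(0)=\theta(0)$.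 Consider the system $$f_\lambda'=-\lambda\coth\rho_\lambda\,\big(I+\theta\theta^T+f_\lambda\theta^T\big)f_\lambda-\theta',\qquad \rho_\lambda'=\lambda(1+\theta^Tf_\lambda),\qquad f_\lambda(0)=0,\ \rho_\lambda(0)=0, \tag{$*$}$$ where a solution consists of functions $f_\lambda,\rho_\lambda$ that are continuous on $[0,1]$, with $\rho_\lambda>0$ and the two differential equations holding on $(0,1]$. (i) There is $\lambda_0>0$ such that for all $\lambda\ge\lambda_0$ the development $(\eta_\lambda,\rho_\lambda)$ exists, $(\eta_\lambda-\theta,\rho_\lambda)$ solves $(*)$, and $(*)$ has no other solution. (ii) If $f_\lambda$ is the solution of $(*)$ for all sufficiently large $\lambda$, then for every $t\in(0,1]$ and every $n=0,1,\dots,k-1$, $$\lim_{\lambda\to+\infty}\lambda^{n+1}\Big(f_\lambda(t)-\sum_{j=1}^{n}\frac{A_j(t)}{\lambda^j}\Big)=A_{n+1}(t).$$ (iii) Consequently, for every $t\in(0,1]$, as $\lambda\to+\infty$, $$\eta_\lambda(t)=\sum_{j=0}^{k}\frac{A_j(t)}{\lambda^j}+o(\lambda^{-k}).$$ -/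

import Mathlib

open Set Filter Topology MeasureTheory Asymptotics

noncomputable section

namespace PathDev

/-- `ℝ^d` with the Euclidean norm. -/
abbrev E (d : ℕ) := EuclideanSpace ℝ (Fin d)

/-! ### Paths on `[0,1]` -/

/-- Length of a path `γ : [0,1] → ℝ^d`: its total variation. -/
def pathLength {d : ℕ} (γ : ℝ → E d) : ENNReal := eVariationOn γ (Icc 0 1)

/-- Natural parametrization: finite length `L`, and speed `L` at almost every time in `[0,1]`. -/
def IsNaturallyParametrized {d : ℕ} (γ : ℝ → E d) : Prop :=
  pathLength γ ≠ ⊤ ∧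
    ∀ᵐ t ∂(volume.restrict (Icc (0 : ℝ) 1)),
      ∃ v : E d, HasDerivWithinAt γ v (Icc 0 1) t ∧ ‖v‖ = (pathLength γ).toReal

/-- The derivative of a function on `[0,1]`, one-sided at the two end points. -/
def ddt {d : ℕ} (g : ℝ → E d) (t : ℝ) : E d := derivWithin g (Icc 0 1) t

/-! ### Development onto the hyperboloid -/

/-- The matrix `F(x)`, with blocks `0`, `x`, `xᵀ`, `0`. -/
def F {d : ℕ} (x : E d) : Matrix (Fin d ⊕ Unit) (Fin d ⊕ Unit) ℝ :=
  Matrix.fromBlocks 0 (Matrix.of fun i _ => x i) (Matrix.of fun _ j => x j) 0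

/-- The base point `o = (0, …, 0, 1)ᵀ` of the hyperboloid. -/
def basePoint (d : ℕ) : Fin d ⊕ Unit → ℝ := Sum.elim (fun _ => 0) (fun _ => 1)

/-- `Γ` is the Cartan development of the `C¹` path `β` over `[0,1]`:
`dΓ(t) = F(dβ(t)) Γ(t)` and `Γ(0) = I`. The derivative of `Γ` is taken entry by entry. -/
def IsCartanDevelopment {d : ℕ} (β : ℝ → E d)
    (Γ : ℝ → Matrix (Fin d ⊕ Unit) (Fin d ⊕ Unit) ℝ) : Prop :=
  Γ 0 = 1 ∧
    ∀ t ∈ Icc (0 : ℝ) 1, ∀ i j,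
      HasDerivWithinAt (fun s => Γ s i j) ((F (ddt β t) * Γ t) i j) (Icc 0 1) t

/-- `(η, ρ)` are the polar coordinates of the development `Γ(t) o` of `β` on the hyperboloid:
`Γ(t) o = (η(t) sinh ρ(t), cosh ρ(t))` with `η(t)` a unit vector and `ρ(t) ≥ 0`.
As `ρ(0) = 0`, this does not determine `η(0)`; by convention it is the initial direction of `β`. -/
def IsHyperbolicDevelopment {d : ℕ} (β : ℝ → E d) (η : ℝ → E d) (ρ : ℝ → ℝ) : Prop :=
  (∃ Γ, IsCartanDevelopment β Γ ∧
    ∀ t ∈ Icc (0 : ℝ) 1, ‖η t‖ = 1 ∧ 0 ≤ ρ t ∧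
      (Γ t).mulVec (basePoint d) =
        Sum.elim (fun i => η t i * Real.sinh (ρ t)) (fun _ => Real.cosh (ρ t))) ∧
  η 0 = ‖ddt β 0‖⁻¹ • ddt β 0

/-! ### The differential equation and the coefficients -/

/-- The matrix `u vᵀ`. -/
def outer {d : ℕ} (u v : E d) : Matrix (Fin d) (Fin d) ℝ := Matrix.of fun i j => u i * v j

/-- A square matrix acting on `ℝ^d`. -/
def act {d : ℕ} (M : Matrix (Fin d) (Fin d) ℝ) (v : E d) : E d := Matrix.toEuclideanLin M v

/-- `P(t) = I + θ(t) θ(t)ᵀ`. -/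
def P {d : ℕ} (θ : ℝ → E d) (t : ℝ) : Matrix (Fin d) (Fin d) ℝ := 1 + outer (θ t) (θ t)

/-- `(f, ρ)` solves, on `[0,1]`, the system
`f' = -λ coth ρ (I + θ θᵀ + f θᵀ) f - θ'`, `ρ' = λ (1 + θᵀ f)`, `f(0) = 0`, `ρ(0) = 0`, `ρ ≥ 0`.
It is singular at `t = 0`, where `ρ = 0`: solutions are continuous on `[0,1]`, have
`ρ > 0` on `(0,1]`, and satisfy the two equations on `(0,1]`. -/
def SolvesSystem {d : ℕ} (θ : ℝ → E d) (lam : ℝ) (f : ℝ → E d) (ρ : ℝ → ℝ) : Prop :=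
  f 0 = 0 ∧ ρ 0 = 0 ∧ ContinuousOn f (Icc 0 1) ∧ ContinuousOn ρ (Icc 0 1) ∧
    ∀ t ∈ Ioc (0 : ℝ) 1, 0 < ρ t ∧
      HasDerivWithinAt f
        (-(lam * (Real.cosh (ρ t) / Real.sinh (ρ t))) • act (P θ t + outer (f t) (θ t)) (f t)
          - ddt θ t) (Icc 0 1) t ∧
      HasDerivWithinAt ρ (lam * (1 + inner ℝ (θ t) (f t))) (Icc 0 1) t

/-- The coefficients: `A₀ = θ` and
`A_{n+1} = -P⁻¹ (A_n' + ∑_{j=1}^{n} A_j θᵀ A_{n+1-j})`; the sum is indexed by `i = j - 1`. -/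
def A {d : ℕ} (θ : ℝ → E d) : ℕ → ℝ → E d
  | 0 => θ
  | n + 1 => fun t =>
      -act (P θ t)⁻¹ (ddt (A θ n) t +
        ∑ i : Fin n, act (outer (A θ (i + 1) t) (θ t)) (A θ (n - i) t))

theorem A_succ {d : ℕ} (θ : ℝ → E d) (n : ℕ) (t : ℝ) :
    A θ (n + 1) t = -act (P θ t)⁻¹ (ddt (A θ n) t +
      ∑ j ∈ Finset.Icc 1 n, act (outer (A θ j t) (θ t)) (A θ (n + 1 - j) t)) := by
  have h : ∀ B : ℕ → ℕ → E d,
      ∑ i : Fin n, B (i + 1) (n - i) = ∑ j ∈ Finset.Icc 1 n, B j (n + 1 - j) := by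
    intro B
    rw [Fin.sum_univ_eq_sum_range (fun i => B (i + 1) (n - i)) n]
    refine Finset.sum_bij (fun i _ => i + 1) ?_ ?_ ?_ ?_
    · intro i hi
      simp only [Finset.mem_range, Finset.mem_Icc] at hi ⊢
      omega
    · intro a _ b _ hab
      omega
    · intro b hb
      simp only [Finset.mem_Icc] at hb
      exact ⟨b - 1, by simp only [Finset.mem_range]; omega, by omega⟩
    · intro i _
      rw [Nat.add_sub_add_right]
  rw [A]
  beta_reduce
  rw [h (fun i j => act (outer (A θ i t) (θ t)) (A θ j t))]

theorem A_one {d : ℕ} (θ : ℝ → E d) (t : ℝ) : A θ 1 t = -act (P θ t)⁻¹ (ddt θ t) := by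
  have h0 : A θ 0 = θ := by rw [A]
  rw [A_succ, h0]
  simp only [show Finset.Icc 1 0 = (∅ : Finset ℕ) from rfl, Finset.sum_empty, add_zero]

end PathDev

end

/-!
The polar coordinates `(η, ρ)` linearize the singular system. If `(f, ρ)` solves it and `η = θ + f`,
then `x = sinh ρ • η`, `y = cosh ρ` solve the regular linear system `x' = λ y θ`, `y' = λ θᵀ x`
with `x(0) = 0`, `y(0) = 1`, which is the equation of the last column of the Cartan development
(`SolvesSystem.isHyperboloidCurve`, `IsCartanDevelopment.isHyperboloidCurve`). Linear uniqueness
therefore gives uniqueness for the singular system (`SolvesSystem.unique`). Conversely the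
development exists on all of `[0,1]` (`exists_linear_ode_matrix`), stays on the hyperboloid
`y² - ‖x‖² = 1`, and satisfies `(θᵀ x)' = θ'ᵀ x + λ y > 0` as soon as `λ > sup ‖θ'‖`
(`IsHyperboloidCurve.inner_pos`). So `x` does not vanish after time `0`, its polar coordinates are
smooth there, and they solve the singular system (`IsHyperbolicDevelopment.solvesSystem`).

For the asymptotics, `θ` and `θ + f` are unit vectors with positive inner product, which turns the
equation for `‖f‖²` into a damped one and gives `‖f‖ ≤ 2 sup ‖θ'‖ / λ` on `[0,1]`
(`SolvesSystem.norm_le`). The coefficients `A_j` are such that the partial sum `g` of order `n`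
solves the equation for `f`, with `coth ρ` replaced by `1`, up to the term `λ⁻ⁿ P A_{n+1}` and
smaller ones (`ddt_add_sum_ddt`). Hence the rescaled remainder `R = λ^(n+1) (f - g)` satisfies
`R' = -λ (P (R - A_{n+1}) + small)` away from `t = 0`, where `coth ρ - 1` is exponentially small.
As `P ≥ I`, `R` relaxes to `A_{n+1}` at rate `λ`, and continuity of `A_{n+1}` is enough to conclude
(`norm_sq_le_of_relaxation`, `tendsto_rescaled_sub`).
-/

namespace PathDev

/-! ### Scalar comparison and linear differential equations -/

/-- The comparison principle for `q' ≤ -c (q - m)`: the excess of `q` over `m` decays at rate `c`. -/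
theorem scalar_decay {q q' : ℝ → ℝ} {a b c m : ℝ} (hab : a ≤ b) (hq : ContinuousOn q (Icc a b))
    (hd : ∀ t ∈ Ioo a b, HasDerivAt q (q' t) t) (hle : ∀ t ∈ Ioo a b, q' t ≤ -c * (q t - m)) :
    q b - m ≤ (q a - m) * Real.exp (-c * (b - a)) := by
  have hd' : ∀ t ∈ Ioo a b, HasDerivAt (fun s => (q s - m) * Real.exp (c * (s - a)))
      (q' t * Real.exp (c * (t - a)) + (q t - m) * (Real.exp (c * (t - a)) * (c * 1))) t := by
    intro t ht
    exact ((hd t ht).sub_const m).mul ((((hasDerivAt_id t).sub_const a).const_mul c).exp)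
  have hanti : AntitoneOn (fun s => (q s - m) * Real.exp (c * (s - a))) (Icc a b) := by
    apply antitoneOn_of_deriv_nonpos (convex_Icc a b)
    · exact (hq.sub continuousOn_const).mul (by fun_prop)
    · rw [interior_Icc]
      exact fun t ht => (hd' t ht).differentiableAt.differentiableWithinAt
    · rw [interior_Icc]
      intro t ht
      rw [(hd' t ht).deriv]
      have h1 := hle t ht
      have h2 := Real.exp_pos (c * (t - a))
      nlinarith
  have h := hanti (left_mem_Icc.2 hab) (right_mem_Icc.2 hab) hab
  simp only [sub_self, mul_zero, Real.exp_zero, mul_one] at h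
  have h2 : Real.exp (c * (b - a)) * Real.exp (-c * (b - a)) = 1 := by
    rw [← Real.exp_add]; simp
  calc q b - m = (q b - m) * Real.exp (c * (b - a)) * Real.exp (-c * (b - a)) := by
        rw [mul_assoc, h2, mul_one]
    _ ≤ _ := mul_le_mul_of_nonneg_right h (Real.exp_pos _).le

/-- Picard–Lindelöf applies on all of `[0,1]` once the field is cut off outside a large cube, and
Grönwall's inequality shows that the cut-off is never felt. -/
theorem exists_linear_ode_vector {ι : Type*} [Fintype ι]
    (L : ℝ → (ι → ℝ) →L[ℝ] (ι → ℝ)) (hL : ContinuousOn L (Icc 0 1)) (v : ι → ℝ) :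
    ∃ x : ℝ → ι → ℝ, x 0 = v ∧ ∀ t ∈ Icc (0 : ℝ) 1, HasDerivWithinAt x (L t (x t)) (Icc 0 1) t := by
  obtain ⟨C, hC⟩ := isCompact_Icc.exists_bound_of_continuousOn hL
  have hC0 : 0 ≤ C := (norm_nonneg _).trans (hC 0 (by simp))
  set R : ℝ := ‖v‖ * Real.exp C with hR
  have hR0 : 0 ≤ R := by positivity
  set φ : (ι → ℝ) → (ι → ℝ) := fun x i => max (-R) (min R (x i)) with hφ
  have hφlip : ∀ x y, ‖φ x - φ y‖ ≤ ‖x - y‖ := by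
    intro x y
    rw [pi_norm_le_iff_of_nonneg (norm_nonneg _)]
    intro i
    refine le_trans ?_ (norm_le_pi_norm (x - y) i)
    simp only [hφ, Pi.sub_apply, Real.norm_eq_abs]
    refine (abs_max_sub_max_le_max (-R) (min R (x i)) (-R) (min R (y i))).trans ?_
    have h := abs_min_sub_min_le_max R (x i) R (y i)
    simp only [sub_self, abs_zero] at h ⊢
    exact max_le (abs_nonneg _) (h.trans (max_le (abs_nonneg _) le_rfl))
  have hφ0 : φ 0 = 0 := by
    funext i; simp [hφ, hR0]
  have hφle : ∀ x, ‖φ x‖ ≤ ‖x‖ := fun x => by simpa [hφ0] using hφlip x 0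
  have hφR : ∀ x, ‖φ x‖ ≤ R := by
    intro x
    rw [pi_norm_le_iff_of_nonneg hR0]
    intro i
    simp only [hφ, Real.norm_eq_abs, abs_le]
    exact ⟨le_max_left _ _, max_le (by linarith) (min_le_left _ _)⟩
  have hφid : ∀ x, ‖x‖ ≤ R → φ x = x := by
    intro x hx
    funext i
    have h := (norm_le_pi_norm x i).trans hx
    rw [Real.norm_eq_abs, abs_le] at h
    simp [hφ, h.1, h.2]
  have hPL : IsPicardLindelof (fun t x => L t (φ x)) (tmin := 0) (tmax := 1)
      ⟨0, by simp⟩ v (C * R).toNNReal 0 (C * R).toNNReal C.toNNReal := by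
    refine ⟨fun t ht => ?_, fun x _ => ?_, fun t ht x _ => ?_, ?_⟩
    · refine LipschitzWith.lipschitzOnWith (LipschitzWith.of_dist_le_mul fun x y => ?_)
      rw [dist_eq_norm, dist_eq_norm, ← map_sub, Real.coe_toNNReal _ hC0]
      exact ((L t).le_opNorm _).trans (mul_le_mul (hC t ht) (hφlip x y) (norm_nonneg _) hC0)
    · exact hL.clm_apply continuousOn_const
    · rw [Real.coe_toNNReal _ (by positivity)]
      exact ((L t).le_opNorm _).trans (mul_le_mul (hC t ht) (hφR x) (norm_nonneg _) hC0)
    · simp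
  obtain ⟨x, hx0, hx⟩ := hPL.exists_eq_forall_mem_Icc_hasDerivWithinAt₀
  refine ⟨x, hx0, fun t ht => ?_⟩
  have hbd := norm_le_gronwallBound_of_norm_deriv_right_le (f := x) (δ := ‖v‖) (K := C) (ε := 0)
    (a := 0) (b := 1) (fun s hs => (hx s hs).continuousWithinAt)
    (fun s hs => (hx s (Ico_subset_Icc_self hs)).mono_of_mem_nhdsWithin
      (Icc_mem_nhdsGE_of_mem hs)) (by simp at hx0; rw [hx0])
    (fun s hs => by
      rw [add_zero]
      exact ((L s).le_opNorm _).trans (mul_le_mul (hC s (Ico_subset_Icc_self hs)) (hφle _)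
        (norm_nonneg _) hC0)) t ht
  rw [gronwallBound_ε0, sub_zero] at hbd
  have hle : ‖x t‖ ≤ R := hbd.trans (by rw [hR]; gcongr; nlinarith [ht.2])
  have := hx t ht
  simp only [hφid _ hle] at this
  exact this

theorem exists_linear_ode_matrix {ι : Type*} [Fintype ι] [DecidableEq ι]
    (a : ℝ → Matrix ι ι ℝ) (ha : ContinuousOn a (Icc 0 1)) :
    ∃ Γ : ℝ → Matrix ι ι ℝ, Γ 0 = 1 ∧ ∀ t ∈ Icc (0 : ℝ) 1, ∀ i j,
      HasDerivWithinAt (fun s => Γ s i j) ((a t * Γ t) i j) (Icc 0 1) t := by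
  set T : Matrix ι ι ℝ →ₗ[ℝ] ((ι → ℝ) →L[ℝ] (ι → ℝ)) :=
    (LinearMap.toContinuousLinearMap (𝕜 := ℝ) (E := ι → ℝ) (F' := ι → ℝ)).toLinearMap ∘ₗ
      (Matrix.toLin' (R := ℝ) (m := ι) (n := ι)).toLinearMap with hT
  have hTc : Continuous T := LinearMap.continuous_of_finiteDimensional T
  choose x hx0 hx using fun j : ι =>
    exists_linear_ode_vector (fun t => T (a t)) (hTc.comp_continuousOn ha) (Pi.single j 1)
  refine ⟨fun s => Matrix.of fun i j => x j s i, ?_, fun t ht i j => ?_⟩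
  · ext i j
    simp [hx0, Pi.single_apply, Matrix.one_apply]
  · have h := hasDerivWithinAt_pi.1 (hx j t ht) i
    simpa [hT, Matrix.mulVec, dotProduct, Matrix.mul_apply] using h

/-! ### Rank-one matrices -/

theorem act_outer {d : ℕ} (u w v : E d) : act (outer u w) v = inner ℝ w v • u := by
  ext i
  simp [act, outer, Matrix.toLpLin_apply, Matrix.mulVec, dotProduct, PiLp.inner_apply,
    mul_assoc, Finset.mul_sum, mul_comm]

theorem act_add {d : ℕ} (M N : Matrix (Fin d) (Fin d) ℝ) (v : E d) :
    act (M + N) v = act M v + act N v := by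
  simp [act, map_add]

theorem act_one {d : ℕ} (v : E d) : act (1 : Matrix (Fin d) (Fin d) ℝ) v = v := by
  simp [act]

theorem act_P {d : ℕ} (θ : ℝ → E d) (t : ℝ) (v : E d) :
    act (P θ t) v = v + inner ℝ (θ t) v • θ t := by
  rw [P, act_add, act_one, act_outer]

/-- For a unit vector `θ`, the inverse of `I + θ θᵀ` is `I - θ θᵀ / 2`. -/
theorem act_P_inv {d : ℕ} (θ : ℝ → E d) (t : ℝ) (h : ‖θ t‖ = 1) (v : E d) :
    act (P θ t)⁻¹ v = v - (1 / 2 * inner ℝ (θ t) v) • θ t := by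
  have hθ : ∑ i, θ t i * θ t i = 1 := by
    have := real_inner_self_eq_norm_sq (θ t)
    rw [h, PiLp.inner_apply] at this
    simpa [sq] using this
  have hsq : outer (θ t) (θ t) * outer (θ t) (θ t) = outer (θ t) (θ t) := by
    ext i j
    simp only [outer, Matrix.mul_apply, Matrix.of_apply]
    calc ∑ k, θ t i * θ t k * (θ t k * θ t j) = θ t i * (∑ k, θ t k * θ t k) * θ t j := by
          rw [Finset.mul_sum, Finset.sum_mul]; exact Finset.sum_congr rfl fun k _ => by ring
      _ = _ := by rw [hθ, mul_one]
  have hinv : (P θ t)⁻¹ = 1 + (-(1 / 2 : ℝ)) • outer (θ t) (θ t) := by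
    apply Matrix.inv_eq_right_inv
    rw [P, mul_add, mul_one, mul_smul_comm, add_mul, one_mul, hsq]
    module
  rw [hinv, act_add, act_one]
  have : act ((-(1 / 2 : ℝ)) • outer (θ t) (θ t)) v = (-(1 / 2 : ℝ)) • act (outer (θ t) (θ t)) v := by
    simp [act, map_smul]
  rw [this, act_outer]
  module

/-! ### The linear system on the hyperboloid -/

/-- `(x, y)` is the curve `Γ(t) o` on the hyperboloid, written as a vector `x` and a height `y`:
it solves `x' = λ y θ`, `y' = λ θᵀ x`, starting from `(0, 1)`. The equations are required on the
open interval only, together with continuity up to the end points. -/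
structure IsHyperboloidCurve {d : ℕ} (θ : ℝ → E d) (lam : ℝ) (x : ℝ → E d) (y : ℝ → ℝ) :
    Prop where
  x_zero : x 0 = 0
  y_zero : y 0 = 1
  continuousOn_x : ContinuousOn x (Icc 0 1)
  continuousOn_y : ContinuousOn y (Icc 0 1)
  hasDerivAt_x : ∀ t ∈ Ioo (0 : ℝ) 1, HasDerivAt x ((lam * y t) • θ t) t
  hasDerivAt_y : ∀ t ∈ Ioo (0 : ℝ) 1, HasDerivAt y (lam * inner ℝ (θ t) (x t)) t

namespace IsHyperboloidCurve

variable {d : ℕ} {θ : ℝ → E d} {lam : ℝ} {x x' : ℝ → E d} {y y' : ℝ → ℝ}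

/-- Uniqueness: the energy `‖x - x'‖² + (y - y')²` of a difference grows at rate at most `2 λ`, and
it vanishes at time `0`. -/
theorem eqOn (hlam : 0 ≤ lam) (hθ : ∀ t ∈ Icc (0 : ℝ) 1, ‖θ t‖ = 1)
    (h : IsHyperboloidCurve θ lam x y) (h' : IsHyperboloidCurve θ lam x' y') {t : ℝ}
    (ht : t ∈ Icc (0 : ℝ) 1) : x t = x' t ∧ y t = y' t := by
  have hsub : Icc 0 t ⊆ Icc (0 : ℝ) 1 := Icc_subset_Icc_right ht.2
  have key := scalar_decay (q := fun s => ‖x s - x' s‖ ^ 2 + (y s - y' s) ^ 2)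
    (q' := fun s => 2 * inner ℝ (x s - x' s) ((lam * y s) • θ s - (lam * y' s) • θ s) +
      2 * (y s - y' s) * (lam * inner ℝ (θ s) (x s) - lam * inner ℝ (θ s) (x' s)))
    (a := 0) (b := t) (c := -(2 * lam)) (m := 0) ht.1
    (ContinuousOn.mono (by
      exact ((h.continuousOn_x.sub h'.continuousOn_x).norm.pow 2).add
        ((h.continuousOn_y.sub h'.continuousOn_y).pow 2)) hsub)
    (fun s hs => by
      have hs' : s ∈ Ioo (0 : ℝ) 1 := ⟨hs.1, hs.2.trans_le ht.2⟩
      have h2 := ((h.hasDerivAt_y s hs').sub (h'.hasDerivAt_y s hs')).pow 2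
      refine (((h.hasDerivAt_x s hs').sub (h'.hasDerivAt_x s hs')).norm_sq.add h2).congr_deriv ?_
      simp)
    (fun s hs => by
      have hs' : s ∈ Icc (0 : ℝ) 1 := ⟨hs.1.le, hs.2.le.trans ht.2⟩
      have h1 : (inner ℝ (θ s) (x s - x' s)) ^ 2 ≤ ‖x s - x' s‖ ^ 2 := by
        have := abs_real_inner_le_norm (θ s) (x s - x' s)
        rw [hθ s hs', one_mul] at this
        exact sq_le_sq' (by linarith [(abs_le.1 this).1]) (abs_le.1 this).2
      rw [← sub_smul, inner_smul_right, ← mul_sub, ← mul_sub, ← inner_sub_right,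
        real_inner_comm (θ s)]
      set u := inner ℝ (θ s) (x s - x' s)
      nlinarith [mul_nonneg hlam (sq_nonneg (u - (y s - y' s))), mul_le_mul_of_nonneg_left h1 hlam])
  simp only [h.x_zero, h'.x_zero, h.y_zero, h'.y_zero, sub_self, norm_zero, sub_zero] at key
  norm_num at key
  have h1 := sq_nonneg ‖x t - x' t‖
  have h2 := sq_nonneg (y t - y' t)
  have h3 : ‖x t - x' t‖ ^ 2 = 0 := by linarith
  have h4 : (y t - y' t) ^ 2 = 0 := by linarith
  exact ⟨sub_eq_zero.1 (norm_eq_zero.1 (pow_eq_zero_iff two_ne_zero |>.1 h3)),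
    sub_eq_zero.1 (pow_eq_zero_iff two_ne_zero |>.1 h4)⟩

theorem sq_sub_norm_sq (h : IsHyperboloidCurve θ lam x y) {t : ℝ} (ht : t ∈ Icc (0 : ℝ) 1) :
    y t ^ 2 - ‖x t‖ ^ 2 = 1 := by
  have hc : ContinuousOn (fun s => y s ^ 2 - ‖x s‖ ^ 2) (Icc 0 1) :=
    (h.continuousOn_y.pow 2).sub (h.continuousOn_x.norm.pow 2)
  have hd : ∀ s ∈ Ioo (0 : ℝ) 1, HasDerivAt (fun s => y s ^ 2 - ‖x s‖ ^ 2) 0 s := by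
    intro s hs
    refine (((h.hasDerivAt_y s hs).pow 2).sub (h.hasDerivAt_x s hs).norm_sq).congr_deriv ?_
    rw [inner_smul_right, real_inner_comm]
    simp
    ring
  have hsub : Icc 0 t ⊆ Icc (0 : ℝ) 1 := Icc_subset_Icc_right ht.2
  have hIoo : ∀ s ∈ Ioo 0 t, s ∈ Ioo (0 : ℝ) 1 := fun s hs => ⟨hs.1, hs.2.trans_le ht.2⟩
  have h1 := scalar_decay (q' := fun _ => 0) (c := 0) (m := 0) ht.1 (hc.mono hsub)
    (fun s hs => hd s (hIoo s hs)) (fun s _ => by simp)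
  have h2 := scalar_decay (q := fun s => -(y s ^ 2 - ‖x s‖ ^ 2)) (q' := fun _ => 0) (c := 0)
    (m := 0) ht.1 (hc.mono hsub).neg
    (fun s hs => (hd s (hIoo s hs)).neg.congr_deriv neg_zero) (fun s _ => by simp)
  simp only [h.x_zero, h.y_zero, norm_zero] at h1 h2
  norm_num at h1 h2
  linarith

theorem one_le (h : IsHyperboloidCurve θ lam x y) {t : ℝ} (ht : t ∈ Icc (0 : ℝ) 1) : 1 ≤ y t := by
  by_contra hlt
  have h1 := h.sq_sub_norm_sq ht
  have hneg : y t ≤ 0 := by nlinarith [sq_nonneg ‖x t‖]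
  obtain ⟨s, hs, hs0⟩ := intermediate_value_Icc' ht.1
    (h.continuousOn_y.mono (Icc_subset_Icc_right ht.2)) ⟨hneg, h.y_zero ▸ zero_le_one⟩
  have h2 := h.sq_sub_norm_sq (t := s) ⟨hs.1, hs.2.trans ht.2⟩
  rw [hs0] at h2
  nlinarith [sq_nonneg ‖x s‖]

/-- As `‖x‖ ≤ y`, the derivative `θ'ᵀ x + λ y` of `θᵀ x` is positive once `λ` exceeds `‖θ'‖`. -/
theorem inner_pos {K : ℝ} (hK : ∀ t ∈ Icc (0 : ℝ) 1, ‖ddt θ t‖ ≤ K)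
    (hθ : ∀ t ∈ Icc (0 : ℝ) 1, ‖θ t‖ = 1)
    (hθd : ∀ t ∈ Icc (0 : ℝ) 1, HasDerivWithinAt θ (ddt θ t) (Icc 0 1) t) (hlam : K < lam)
    (h : IsHyperboloidCurve θ lam x y) {t : ℝ} (ht : t ∈ Ioc (0 : ℝ) 1) :
    0 < inner ℝ (θ t) (x t) := by
  have hd : ∀ s ∈ Ioo (0 : ℝ) 1, HasDerivAt (fun s => inner ℝ (θ s) (x s))
      (inner ℝ (θ s) ((lam * y s) • θ s) + inner ℝ (ddt θ s) (x s)) s := fun s hs =>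
    ((hθd s (Ioo_subset_Icc_self hs)).hasDerivAt (Icc_mem_nhds hs.1 hs.2)).inner ℝ
      (h.hasDerivAt_x s hs)
  have hmono : StrictMonoOn (fun s => inner ℝ (θ s) (x s)) (Icc 0 1) := by
    refine strictMonoOn_of_deriv_pos (convex_Icc 0 1)
      (ContinuousOn.inner (fun s hs => (hθd s hs).continuousWithinAt) h.continuousOn_x) ?_
    rw [interior_Icc]
    intro s hs
    have hs' := Ioo_subset_Icc_self hs
    rw [(hd s hs).deriv, inner_smul_right, real_inner_self_eq_norm_sq, hθ s hs']
    have h1 := h.one_le hs'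
    have h2 := h.sq_sub_norm_sq hs'
    have h3 : ‖x s‖ ≤ y s := by nlinarith [norm_nonneg (x s)]
    have h4 := (abs_le.1 (abs_real_inner_le_norm (ddt θ s) (x s))).1
    have h5 : ‖ddt θ s‖ * ‖x s‖ ≤ K * y s :=
      mul_le_mul (hK s hs') h3 (norm_nonneg _) ((norm_nonneg _).trans (hK s hs'))
    nlinarith
  have := hmono (left_mem_Icc.2 zero_le_one) (Ioc_subset_Icc_self ht) ht.1
  simpa [h.x_zero] using this

end IsHyperboloidCurve

/-! ### From the singular system to the hyperboloid -/

namespace SolvesSystem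

variable {d : ℕ} {θ : ℝ → E d} {lam : ℝ} {f g : ℝ → E d} {ρ σ : ℝ → ℝ}

/-- The right-hand side of the equation for `f`, in terms of `η = θ + f`. -/
theorem act_rhs {t : ℝ} (hθ : ‖θ t‖ = 1) (v : E d) :
    act (P θ t + outer v (θ t)) v = inner ℝ (θ t) (θ t + v) • (θ t + v) - θ t := by
  rw [act_add, act_P, act_outer, inner_add_right, real_inner_self_eq_norm_sq, hθ]
  module

/-- The substitution `x = sinh ρ • η`, `y = cosh ρ` removes the singularity. That `η` is a unit vector
is not used here: it follows from this lemma. -/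
theorem isHyperboloidCurve (hθ : ∀ t ∈ Icc (0 : ℝ) 1, ‖θ t‖ = 1)
    (hθd : ∀ t ∈ Icc (0 : ℝ) 1, HasDerivWithinAt θ (ddt θ t) (Icc 0 1) t)
    (h : SolvesSystem θ lam f ρ) :
    IsHyperboloidCurve θ lam (fun t => Real.sinh (ρ t) • (θ t + f t))
      (fun t => Real.cosh (ρ t)) := by
  obtain ⟨hf0, hρ0, hfc, hρc, hd⟩ := h
  have hθc : ContinuousOn θ (Icc 0 1) := fun s hs => (hθd s hs).continuousWithinAt
  refine ⟨by simp [hρ0], by simp [hρ0], (Real.continuous_sinh.comp_continuousOn hρc).smul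
    (hθc.add hfc), Real.continuous_cosh.comp_continuousOn hρc, fun t ht => ?_, fun t ht => ?_⟩
  · obtain ⟨hpos, hdf, hdρ⟩ := hd t (Ioo_subset_Ioc_self ht)
    have hI := Icc_mem_nhds ht.1 ht.2
    have ht' := Ioo_subset_Icc_self ht
    refine ((hdρ.hasDerivAt hI).sinh.smul
      (((hθd t ht').hasDerivAt hI).add (hdf.hasDerivAt hI))).congr_deriv ?_
    have hs : Real.sinh (ρ t) ≠ 0 := (Real.sinh_pos_iff.2 hpos).ne'
    rw [act_rhs (hθ t ht'), Pi.add_apply]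
    have h1 : 1 + inner ℝ (θ t) (f t) = inner ℝ (θ t) (θ t + f t) := by
      rw [inner_add_right, real_inner_self_eq_norm_sq, hθ t ht', one_pow]
    rw [h1]
    have h2 : Real.sinh (ρ t) * (Real.cosh (ρ t) / Real.sinh (ρ t)) = Real.cosh (ρ t) := by
      field_simp
    rw [show ddt θ t + (-(lam * (Real.cosh (ρ t) / Real.sinh (ρ t))) •
        (inner ℝ (θ t) (θ t + f t) • (θ t + f t) - θ t) - ddt θ t) =
        -(lam * (Real.cosh (ρ t) / Real.sinh (ρ t))) •
        (inner ℝ (θ t) (θ t + f t) • (θ t + f t) - θ t) by abel, smul_smul,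
      show Real.sinh (ρ t) * -(lam * (Real.cosh (ρ t) / Real.sinh (ρ t))) =
        -(lam * (Real.sinh (ρ t) * (Real.cosh (ρ t) / Real.sinh (ρ t)))) by ring, h2]
    module
  · obtain ⟨hpos, hdf, hdρ⟩ := hd t (Ioo_subset_Ioc_self ht)
    refine ((hdρ.hasDerivAt (Icc_mem_nhds ht.1 ht.2)).cosh).congr_deriv ?_
    rw [inner_smul_right, inner_add_right, real_inner_self_eq_norm_sq,
      hθ t (Ioo_subset_Icc_self ht)]
    ring

theorem norm_add_eq_one (hθ : ∀ t ∈ Icc (0 : ℝ) 1, ‖θ t‖ = 1)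
    (hθd : ∀ t ∈ Icc (0 : ℝ) 1, HasDerivWithinAt θ (ddt θ t) (Icc 0 1) t)
    (h : SolvesSystem θ lam f ρ) {t : ℝ} (ht : t ∈ Ioc (0 : ℝ) 1) : ‖θ t + f t‖ = 1 := by
  have h1 := (h.isHyperboloidCurve hθ hθd).sq_sub_norm_sq (Ioc_subset_Icc_self ht)
  have hs := Real.sinh_pos_iff.2 (h.2.2.2.2 t ht).1
  simp only [norm_smul, Real.norm_eq_abs, abs_of_pos hs, mul_pow, Real.cosh_sq] at h1
  have h2 : Real.sinh (ρ t) ^ 2 * (‖θ t + f t‖ ^ 2 - 1) = 0 := by linarith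
  have h3 : ‖θ t + f t‖ ^ 2 = 1 := by
    rcases mul_eq_zero.1 h2 with h | h
    · exact absurd h (by positivity)
    · linarith
  exact (pow_eq_one_iff_of_nonneg (norm_nonneg _) two_ne_zero).1 h3

/-- The hyperboloid curve determines `ρ > 0` through `cosh ρ` and then `f` through
`sinh ρ • (θ + f)`. -/
theorem unique (hlam : 0 ≤ lam) (hθ : ∀ t ∈ Icc (0 : ℝ) 1, ‖θ t‖ = 1)
    (hθd : ∀ t ∈ Icc (0 : ℝ) 1, HasDerivWithinAt θ (ddt θ t) (Icc 0 1) t)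
    (h : SolvesSystem θ lam f ρ) (h' : SolvesSystem θ lam g σ) :
    EqOn f g (Icc 0 1) ∧ EqOn ρ σ (Icc 0 1) := by
  have key : ∀ t ∈ Icc (0 : ℝ) 1, f t = g t ∧ ρ t = σ t := by
    intro t ht
    rcases ht.1.eq_or_lt with h0 | h0
    · rw [← h0, h.1, h'.1, h.2.1, h'.2.1]; simp
    obtain ⟨hx, hy⟩ := (h.isHyperboloidCurve hθ hθd).eqOn hlam hθ
      (h'.isHyperboloidCurve hθ hθd) ht
    have hρ := (h.2.2.2.2 t ⟨h0, ht.2⟩).1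
    have hσ := (h'.2.2.2.2 t ⟨h0, ht.2⟩).1
    have he : ρ t = σ t := Real.cosh_strictMonoOn.injOn hρ.le hσ.le hy
    refine ⟨?_, he⟩
    simp only [he] at hx
    exact add_left_cancel (smul_right_injective _ (Real.sinh_pos_iff.2 hσ).ne' hx)
  exact ⟨fun t ht => (key t ht).1, fun t ht => (key t ht).2⟩

/-- The a priori bound `f = O(1/λ)`, uniform on `[0,1]`. Since `θ` and `θ + f` are unit vectors,
`θᵀ f = -‖f‖² / 2`, so that `q = ‖f‖²` satisfies
`q' ≤ -2 λ coth ρ · q (1 - q / 4) + 2 K √q` with `q ≤ 2`. -/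
theorem norm_le {K : ℝ} (hK : ∀ t ∈ Icc (0 : ℝ) 1, ‖ddt θ t‖ ≤ K)
    (hθ : ∀ t ∈ Icc (0 : ℝ) 1, ‖θ t‖ = 1)
    (hθd : ∀ t ∈ Icc (0 : ℝ) 1, HasDerivWithinAt θ (ddt θ t) (Icc 0 1) t) (hlam : K < lam)
    (h : SolvesSystem θ lam f ρ) {t : ℝ} (ht : t ∈ Icc (0 : ℝ) 1) : ‖f t‖ ≤ 2 * K / lam := by
  have hK0 : 0 ≤ K := (norm_nonneg _).trans (hK 0 (by simp))
  have hl : 0 < lam := hK0.trans_lt hlam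
  have hcurve := h.isHyperboloidCurve hθ hθd
  have key := scalar_decay (q := fun s => ‖f s‖ ^ 2)
    (q' := fun s => 2 * inner ℝ (f s) (-(lam * (Real.cosh (ρ s) / Real.sinh (ρ s))) •
      act (P θ s + outer (f s) (θ s)) (f s) - ddt θ s))
    (a := 0) (b := t) (c := lam / 2) (m := (2 * K / lam) ^ 2) ht.1
    ((h.2.2.1.norm.pow 2).mono (Icc_subset_Icc_right ht.2))
    (fun s hs => by
      have hs1 : s < 1 := hs.2.trans_le ht.2
      exact ((h.2.2.2.2 s ⟨hs.1, hs1.le⟩).2.1.hasDerivAt (Icc_mem_nhds hs.1 hs1)).norm_sq)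
    (fun s hs => by
      have hs1 : s ∈ Ioc (0 : ℝ) 1 := ⟨hs.1, hs.2.le.trans ht.2⟩
      have hs' := Ioc_subset_Icc_self hs1
      have hsinh := Real.sinh_pos_iff.2 (h.2.2.2.2 s hs1).1
      have hη := h.norm_add_eq_one hθ hθd hs1
      have hpos := hcurve.inner_pos hK hθ hθd hlam hs1
      rw [inner_smul_right] at hpos
      have hpos' := (mul_pos_iff_of_pos_left hsinh).1 hpos
      rw [inner_add_right, real_inner_self_eq_norm_sq, hθ s hs'] at hpos'
      have hexp := norm_add_sq_real (θ s) (f s)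
      rw [hη, hθ s hs'] at hexp
      have hc : 1 ≤ Real.cosh (ρ s) / Real.sinh (ρ s) := by
        rw [le_div_iff₀ hsinh, one_mul]; exact (Real.sinh_lt_cosh _).le
      have h4 := (abs_le.1 (abs_real_inner_le_norm (f s) (ddt θ s))).1
      have h5 : ‖f s‖ * ‖ddt θ s‖ ≤ ‖f s‖ * K := by gcongr; exact hK s hs'
      rw [act_add, act_P, act_outer, inner_sub_right, inner_smul_right, inner_add_right,
        inner_add_right, inner_smul_right, inner_smul_right, real_inner_self_eq_norm_sq,
        real_inner_comm (θ s) (f s)]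
      set c := Real.cosh (ρ s) / Real.sinh (ρ s)
      set p := inner ℝ (θ s) (f s) with hp
      have hpq : p = -(‖f s‖ ^ 2) / 2 := by linarith
      set r := ‖f s‖ with hr
      have hm : lam * (2 * K / lam) = 2 * K := by field_simp
      set m := 2 * K / lam
      have hq2 : r ^ 2 ≤ 2 := by linarith
      have hb : r ^ 2 / 2 ≤ r ^ 2 + p * p + p * r ^ 2 := by
        rw [hpq]; nlinarith [sq_nonneg r]
      have hlc : lam * (r ^ 2 / 2) ≤ lam * c * (r ^ 2 + p * p + p * r ^ 2) := by
        rw [mul_assoc]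
        refine mul_le_mul_of_nonneg_left ?_ hl.le
        nlinarith [sq_nonneg r]
      have hlm : 2 * (r * K) ≤ lam / 2 * (r ^ 2 + m ^ 2) := by
        rw [show r * K = r * (lam * m) / 2 by rw [hm]; ring]
        nlinarith [mul_nonneg hl.le (sq_nonneg (r - m))]
      linarith)
  simp only [h.1, norm_zero] at key
  have h1 : ‖f t‖ ^ 2 ≤ (2 * K / lam) ^ 2 := by
    have := Real.exp_pos (-(lam / 2) * (t - 0))
    nlinarith [mul_nonneg (sq_nonneg (2 * K / lam)) this.le]
  exact (sq_le_sq₀ (norm_nonneg _) (by positivity)).1 h1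

end SolvesSystem

/-! ### From the Cartan development to the singular system -/

/-- The first `d` coordinates of `Γ(t) o`. -/
noncomputable def devVec {d : ℕ} (Γ : ℝ → Matrix (Fin d ⊕ Unit) (Fin d ⊕ Unit) ℝ) (t : ℝ) : E d :=
  WithLp.toLp 2 fun i => Γ t (Sum.inl i) (Sum.inr ())

/-- The last coordinate of `Γ(t) o`. -/
def devHeight {d : ℕ} (Γ : ℝ → Matrix (Fin d ⊕ Unit) (Fin d ⊕ Unit) ℝ) (t : ℝ) : ℝ :=
  Γ t (Sum.inr ()) (Sum.inr ())

theorem mulVec_basePoint {d : ℕ} (Γ : ℝ → Matrix (Fin d ⊕ Unit) (Fin d ⊕ Unit) ℝ) (t : ℝ) :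
    (Γ t).mulVec (basePoint d) =
      Sum.elim (fun i => devVec Γ t i) (fun _ => devHeight Γ t) := by
  funext i
  rcases i with i | i <;>
  simp [Matrix.mulVec, dotProduct, basePoint, devVec, devHeight]

namespace IsCartanDevelopment

variable {d : ℕ} {β θ : ℝ → E d} {lam : ℝ} {Γ : ℝ → Matrix (Fin d ⊕ Unit) (Fin d ⊕ Unit) ℝ}

theorem hasDerivWithinAt_devVec (h : IsCartanDevelopment β Γ) {t : ℝ} (ht : t ∈ Icc (0 : ℝ) 1) :
    HasDerivWithinAt (devVec Γ) (devHeight Γ t • ddt β t) (Icc 0 1) t := by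
  have h1 : HasDerivWithinAt (fun s => fun i => Γ s (Sum.inl i) (Sum.inr ()))
      (fun i => devHeight Γ t * ddt β t i) (Icc 0 1) t := by
    refine hasDerivWithinAt_pi.2 fun i => (h.2 t ht (Sum.inl i) (Sum.inr ())).congr_deriv ?_
    simp [F, Matrix.mul_apply, devHeight, mul_comm]
  exact (PiLp.continuousLinearEquiv 2 ℝ fun _ : Fin d => ℝ).symm.hasFDerivAt.comp_hasDerivWithinAt
    t h1

theorem hasDerivWithinAt_devHeight (h : IsCartanDevelopment β Γ) {t : ℝ}
    (ht : t ∈ Icc (0 : ℝ) 1) :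
    HasDerivWithinAt (devHeight Γ) (inner ℝ (ddt β t) (devVec Γ t)) (Icc 0 1) t := by
  refine (h.2 t ht (Sum.inr ()) (Sum.inr ())).congr_deriv ?_
  simp [F, Matrix.mul_apply, devVec, PiLp.inner_apply, mul_comm]

theorem isHyperboloidCurve (hβ : ∀ t ∈ Icc (0 : ℝ) 1, ddt β t = lam • θ t)
    (h : IsCartanDevelopment β Γ) : IsHyperboloidCurve θ lam (devVec Γ) (devHeight Γ) where
  x_zero := by
    ext i
    simp [devVec, h.1]
  y_zero := by simp [devHeight, h.1]
  continuousOn_x := fun t ht => (h.hasDerivWithinAt_devVec ht).continuousWithinAt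
  continuousOn_y := fun t ht => (h.hasDerivWithinAt_devHeight ht).continuousWithinAt
  hasDerivAt_x := fun t ht => by
    refine ((h.hasDerivWithinAt_devVec (Ioo_subset_Icc_self ht)).hasDerivAt
      (Icc_mem_nhds ht.1 ht.2)).congr_deriv ?_
    rw [hβ t (Ioo_subset_Icc_self ht), smul_smul, mul_comm]
  hasDerivAt_y := fun t ht => by
    refine ((h.hasDerivWithinAt_devHeight (Ioo_subset_Icc_self ht)).hasDerivAt
      (Icc_mem_nhds ht.1 ht.2)).congr_deriv ?_
    rw [hβ t (Ioo_subset_Icc_self ht), real_inner_smul_left]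

end IsCartanDevelopment

section HyperbolicDevelopment

variable {d : ℕ} {β θ η : ℝ → E d} {lam : ℝ} {ρ : ℝ → ℝ}

/-- Where `x` vanishes the direction `η` is arbitrary; it is set to `θ`, in accordance with the
convention at `t = 0`. -/
theorem exists_isHyperbolicDevelopment (hlam : 0 < lam)
    (hβ : ∀ t ∈ Icc (0 : ℝ) 1, ddt β t = lam • θ t)
    (hθ : ∀ t ∈ Icc (0 : ℝ) 1, ‖θ t‖ = 1) (hθc : ContinuousOn θ (Icc 0 1)) :
    ∃ (η : ℝ → E d) (ρ : ℝ → ℝ), IsHyperbolicDevelopment β η ρ := by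
  have hβc : ContinuousOn (ddt β) (Icc 0 1) := (hθc.const_smul lam).congr hβ
  have hF : Continuous (F : E d → _) := by
    refine continuous_matrix fun i j => ?_
    rcases i with i | i <;> rcases j with j | j <;> simp only [F, Matrix.fromBlocks_apply₁₁,
      Matrix.fromBlocks_apply₁₂, Matrix.fromBlocks_apply₂₁, Matrix.fromBlocks_apply₂₂,
      Matrix.of_apply, Matrix.zero_apply] <;> fun_prop
  obtain ⟨Γ, hΓ0, hΓ⟩ := exists_linear_ode_matrix _ (hF.comp_continuousOn hβc)
  have hΓ' : IsCartanDevelopment β Γ := ⟨hΓ0, hΓ⟩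
  have hcurve := hΓ'.isHyperboloidCurve hβ
  have hx0 : devVec Γ 0 = 0 := hcurve.x_zero
  have h0 : (0 : ℝ) ∈ Icc (0 : ℝ) 1 := by simp
  classical
  refine ⟨fun t => if devVec Γ t = 0 then θ t else ‖devVec Γ t‖⁻¹ • devVec Γ t,
    fun t => Real.arsinh ‖devVec Γ t‖, ⟨Γ, hΓ', fun t ht => ⟨?_, ?_, ?_⟩⟩, ?_⟩
  · beta_reduce
    split_ifs with h
    · exact hθ t ht
    · exact norm_smul_inv_norm (𝕜 := ℝ) h
  · exact Real.arsinh_nonneg_iff.2 (norm_nonneg _)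
  · have hy := hcurve.one_le ht
    have hxy := hcurve.sq_sub_norm_sq ht
    rw [mulVec_basePoint, Real.sinh_arsinh, Real.cosh_arsinh,
      show 1 + ‖devVec Γ t‖ ^ 2 = devHeight Γ t ^ 2 by linarith, Real.sqrt_sq (by linarith)]
    congr 1
    funext i
    beta_reduce
    split_ifs with h
    · simp [h]
    · have : ‖devVec Γ t‖ ≠ 0 := norm_ne_zero_iff.2 h
      simp only [PiLp.smul_apply, smul_eq_mul]
      field_simp
  · simp only [hx0, if_true]
    rw [hβ 0 h0, norm_smul, hθ 0 h0, smul_smul, Real.norm_eq_abs, abs_of_pos hlam, mul_one,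
      inv_mul_cancel₀ hlam.ne', one_smul]

theorem IsHyperbolicDevelopment.solvesSystem {K : ℝ} (hK : ∀ t ∈ Icc (0 : ℝ) 1, ‖ddt θ t‖ ≤ K)
    (hθ : ∀ t ∈ Icc (0 : ℝ) 1, ‖θ t‖ = 1)
    (hθd : ∀ t ∈ Icc (0 : ℝ) 1, HasDerivWithinAt θ (ddt θ t) (Icc 0 1) t) (hlam : K < lam)
    (hβ : ∀ t ∈ Icc (0 : ℝ) 1, ddt β t = lam • θ t)
    (h : IsHyperbolicDevelopment β η ρ) : SolvesSystem θ lam (η - θ) ρ := by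
  have hK0 : 0 ≤ K := (norm_nonneg _).trans (hK 0 (by simp))
  have hl : 0 < lam := hK0.trans_lt hlam
  have h0 : (0 : ℝ) ∈ Icc (0 : ℝ) 1 := by simp
  obtain ⟨⟨Γ, hΓ, hpol⟩, hη0⟩ := h
  have hcurve := hΓ.isHyperboloidCurve hβ
  have hη0' : η 0 = θ 0 := by
    rw [hη0, hβ 0 h0, norm_smul, hθ 0 h0, smul_smul, Real.norm_eq_abs, abs_of_pos hl, mul_one,
      inv_mul_cancel₀ hl.ne', one_smul]
  have hx : ∀ t ∈ Icc (0 : ℝ) 1, devVec Γ t = Real.sinh (ρ t) • η t := by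
    intro t ht
    have := (hpol t ht).2.2
    rw [mulVec_basePoint] at this
    ext i
    have hi := congrFun this (Sum.inl i)
    simp only [Sum.elim_inl] at hi
    rw [hi, PiLp.smul_apply, smul_eq_mul, mul_comm]
  have hy : ∀ t ∈ Icc (0 : ℝ) 1, devHeight Γ t = Real.cosh (ρ t) := by
    intro t ht
    have := (hpol t ht).2.2
    rw [mulVec_basePoint] at this
    simpa using congrFun this (Sum.inr ())
  have hsn : ∀ t ∈ Icc (0 : ℝ) 1, ‖devVec Γ t‖ = Real.sinh (ρ t) := by
    intro t ht
    rw [hx t ht, norm_smul, (hpol t ht).1, mul_one, Real.norm_eq_abs,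
      abs_of_nonneg (Real.sinh_nonneg_iff.2 (hpol t ht).2.1)]
  have hρ : ∀ t ∈ Icc (0 : ℝ) 1, ρ t = Real.arsinh ‖devVec Γ t‖ := by
    intro t ht
    rw [hsn t ht, Real.arsinh_sinh]
  have hx0 : ∀ t ∈ Ioc (0 : ℝ) 1, devVec Γ t ≠ 0 := by
    intro t ht h
    have := hcurve.inner_pos hK hθ hθd hlam ht
    rw [h, inner_zero_right] at this
    exact this.false
  have hη : ∀ t ∈ Ioc (0 : ℝ) 1, η t = ‖devVec Γ t‖⁻¹ • devVec Γ t := by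
    intro t ht
    have ht' := Ioc_subset_Icc_self ht
    have h1 := norm_ne_zero_iff.2 (hx0 t ht)
    rw [eq_inv_smul_iff₀ h1, hsn t ht', ← hx t ht']
  -- At a time `t > 0` the polar coordinates are smooth functions of `x`.
  have hpos : ∀ t ∈ Ioc (0 : ℝ) 1, 0 < Real.sinh (ρ t) := by
    intro t ht
    rw [← hsn t (Ioc_subset_Icc_self ht)]
    exact norm_pos_iff.2 (hx0 t ht)
  have hnd : ∀ t ∈ Ioc (0 : ℝ) 1, HasDerivWithinAt (fun s => ‖devVec Γ s‖)
      (lam * Real.cosh (ρ t) * inner ℝ (θ t) (η t)) (Icc 0 1) t := by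
    intro t ht
    have ht' := Ioc_subset_Icc_self ht
    have h1 := ((hΓ.hasDerivWithinAt_devVec ht').norm_sq.sqrt
      (pow_ne_zero 2 (norm_ne_zero_iff.2 (hx0 t ht))))
    simp only [Real.sqrt_sq (norm_nonneg _)] at h1
    refine h1.congr_deriv ?_
    rw [hsn t ht', hβ t ht', hy t ht', hx t ht', inner_smul_right, inner_smul_right,
      real_inner_smul_left, real_inner_comm]
    field_simp [(hpos t ht).ne']
  have hdρ : ∀ t ∈ Ioc (0 : ℝ) 1, HasDerivWithinAt ρ (lam * (1 + inner ℝ (θ t) ((η - θ) t)))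
      (Icc 0 1) t := by
    intro t ht
    have ht' := Ioc_subset_Icc_self ht
    refine ((hnd t ht).arsinh.congr hρ (hρ t ht')).congr_deriv ?_
    rw [Pi.sub_apply, inner_sub_right, real_inner_self_eq_norm_sq, hθ t ht', hsn t ht',
      show 1 + Real.sinh (ρ t) ^ 2 = Real.cosh (ρ t) ^ 2 by rw [Real.cosh_sq]; ring,
      Real.sqrt_sq (Real.cosh_pos _).le, smul_eq_mul]
    have := (Real.cosh_pos (ρ t)).ne'
    field_simp
    ring
  have hdη : ∀ t ∈ Ioc (0 : ℝ) 1, HasDerivWithinAt η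
      (-(lam * (Real.cosh (ρ t) / Real.sinh (ρ t))) • (inner ℝ (θ t) (η t) • η t - θ t))
      (Icc 0 1) t := by
    intro t ht
    have ht' := Ioc_subset_Icc_self ht
    have h1 := ((hnd t ht).inv (norm_ne_zero_iff.2 (hx0 t ht))).smul (hΓ.hasDerivWithinAt_devVec ht')
    have h2 : HasDerivWithinAt η _ (Ioc 0 1) t := (h1.mono Ioc_subset_Icc_self).congr hη (hη t ht)
    refine (h2.mono_of_mem_nhdsWithin ?_).congr_deriv ?_
    · exact mem_nhdsWithin.2 ⟨Ioi 0, isOpen_Ioi, ht.1, fun s hs => ⟨hs.1, hs.2.2⟩⟩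
    · rw [hsn t ht', hβ t ht', hy t ht', hx t ht']
      have := (hpos t ht).ne'
      simp only [smul_smul, smul_sub, Pi.inv_apply, hsn t ht']
      match_scalars <;> field_simp
  have hηc : ContinuousOn η (Icc 0 1) := by
    intro t ht
    rcases ht.1.eq_or_lt with ht0 | ht0
    · rw [← ht0]
      -- At the initial time `x(t) / t → λ θ(0)`, and `η` is the direction of `x(t) / t`.
      have h1 := hasDerivWithinAt_iff_tendsto_slope.1 (hΓ.hasDerivWithinAt_devVec h0)
      rw [hcurve.y_zero, one_smul, hβ 0 h0] at h1
      have hne : lam • θ 0 ≠ 0 := by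
        rw [← norm_ne_zero_iff, norm_smul, hθ 0 h0, mul_one]
        exact norm_ne_zero_iff.2 hl.ne'
      have h2 := (h1.norm.inv₀ (norm_ne_zero_iff.2 hne)).smul h1
      rw [← continuousWithinAt_sdiff_self, ContinuousWithinAt, hη0, hβ 0 h0]
      refine h2.congr' ?_
      filter_upwards [self_mem_nhdsWithin] with s hs
      have hs0 : 0 < s := lt_of_le_of_ne hs.1.1 fun h => hs.2 h.symm
      rw [hη s ⟨hs0, hs.1.2⟩, slope_def_module, hcurve.x_zero, sub_zero, sub_zero, norm_smul,
        smul_smul, norm_inv, Real.norm_eq_abs, abs_of_pos hs0]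
      congr 1
      field_simp
    · exact (hdη t ⟨ht0, ht.2⟩).continuousWithinAt
  refine ⟨by simp [hη0'], ?_, hηc.sub fun s hs => (hθd s hs).continuousWithinAt, ?_,
    fun t ht => ⟨?_, ?_, hdρ t ht⟩⟩
  · rw [hρ 0 h0, hcurve.x_zero, norm_zero, Real.arsinh_zero]
  · exact (hcurve.continuousOn_x.norm.arsinh).congr hρ
  · exact Real.sinh_pos_iff.1 (hpos t ht)
  · have ht' := Ioc_subset_Icc_self ht
    refine ((hdη t ht).sub (hθd t ht')).congr_deriv ?_
    rw [SolvesSystem.act_rhs (hθ t ht')]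
    simp

end HyperbolicDevelopment

/-! ### The coefficients -/

section Coefficients

variable {d k : ℕ} {θ : ℝ → E d}

theorem A_zero (θ : ℝ → E d) : A θ 0 = θ := by rw [A]

theorem A_succ_eq_of_norm_eq_one (n : ℕ) {t : ℝ} (ht : ‖θ t‖ = 1) {w : E d}
    (hw : w = ddt (A θ n) t + ∑ j ∈ Finset.Icc 1 n, inner ℝ (θ t) (A θ (n + 1 - j) t) • A θ j t) :
    A θ (n + 1) t = -(w - (1 / 2 * inner ℝ (θ t) w) • θ t) := by
  rw [A_succ, act_P_inv θ t ht, hw]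
  simp only [act_outer]

/-- Each coefficient costs one derivative. -/
theorem contDiffOn_A (hθk : ContDiffOn ℝ k θ (Icc 0 1)) (hθ : ∀ t ∈ Icc (0 : ℝ) 1, ‖θ t‖ = 1) :
    ∀ n m : ℕ, n + m ≤ k → ContDiffOn ℝ m (A θ n) (Icc 0 1) := by
  intro n
  induction n using Nat.strong_induction_on with
  | _ n ih =>
    intro m hm
    rcases n with _ | n
    · rw [A_zero]
      exact hθk.of_le (by exact_mod_cast (by omega))
    · have hθm : ContDiffOn ℝ m θ (Icc 0 1) := hθk.of_le (by exact_mod_cast (by omega))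
      have hw : ContDiffOn ℝ m (fun t => ddt (A θ n) t + ∑ j ∈ Finset.Icc 1 n,
          inner ℝ (θ t) (A θ (n + 1 - j) t) • A θ j t) (Icc 0 1) := by
        refine ContDiffOn.add ?_ (ContDiffOn.sum fun j hj => ?_)
        · exact (ih n n.lt_succ_self (m + 1) (by omega)).derivWithin
            (uniqueDiffOn_Icc zero_lt_one) (by norm_cast)
        · rw [Finset.mem_Icc] at hj
          exact (hθm.inner ℝ (ih (n + 1 - j) (by omega) m (by omega))).smul
            (ih j (by omega) m (by omega))
      refine ContDiffOn.congr ?_ fun t ht => A_succ_eq_of_norm_eq_one n (hθ t ht) rfl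
      exact (hw.sub ((contDiffOn_const.mul (hθm.inner ℝ hw)).smul hθm)).neg

/-- The recursion, solved for the derivative of `A n`. -/
theorem ddt_A (n : ℕ) {t : ℝ} (ht : ‖θ t‖ = 1) :
    ddt (A θ n) t = -(A θ (n + 1) t + inner ℝ (θ t) (A θ (n + 1) t) • θ t) -
      ∑ j ∈ Finset.Icc 1 n, inner ℝ (θ t) (A θ (n + 1 - j) t) • A θ j t := by
  set w := ddt (A θ n) t + ∑ j ∈ Finset.Icc 1 n, inner ℝ (θ t) (A θ (n + 1 - j) t) • A θ j t
    with hw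
  have h1 := A_succ_eq_of_norm_eq_one n ht hw
  have h2 : ddt (A θ n) t =
      w - ∑ j ∈ Finset.Icc 1 n, inner ℝ (θ t) (A θ (n + 1 - j) t) • A θ j t := by
    rw [hw, add_sub_cancel_right]
  rw [h2]
  congr 1
  rw [h1, inner_neg_right, inner_sub_right, inner_smul_right, real_inner_self_eq_norm_sq, ht]
  module

/-- A square of indices `1 ≤ i, l ≤ n`, split along the antidiagonal `i + l = n + 1`. -/
theorem sum_square_eq_sum_triangle_add {V : Type*} [AddCommMonoid V] (B : ℕ → ℕ → V) (n : ℕ) :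
    ∑ i ∈ Finset.Icc 1 n, ∑ l ∈ Finset.Icc 1 n, B i l =
      ∑ j ∈ Finset.range (n + 1), ∑ i ∈ Finset.Icc 1 j, B i (j + 1 - i) +
      ∑ p ∈ (Finset.Icc 1 n ×ˢ Finset.Icc 1 n).filter (fun p => n + 2 ≤ p.1 + p.2),
        B p.1 p.2 := by
  rw [← Finset.sum_product', add_comm,
    ← Finset.sum_filter_add_sum_filter_not _ (fun p : ℕ × ℕ => n + 2 ≤ p.1 + p.2)]
  congr 1
  rw [Finset.sum_sigma']
  refine Finset.sum_bij' (fun p _ => ⟨p.1 + p.2 - 1, p.1⟩) (fun q _ => (q.2, q.1 + 1 - q.2))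
    ?_ ?_ ?_ ?_ ?_
  · rintro ⟨i, l⟩ h
    simp only [Finset.mem_filter, Finset.mem_product, Finset.mem_Icc] at h
    simp only [Finset.mem_sigma, Finset.mem_range, Finset.mem_Icc]
    omega
  · rintro ⟨j, i⟩ h
    simp only [Finset.mem_sigma, Finset.mem_range, Finset.mem_Icc] at h
    simp only [Finset.mem_filter, Finset.mem_product, Finset.mem_Icc]
    omega
  · rintro ⟨i, l⟩ h
    simp only [Finset.mem_filter, Finset.mem_product, Finset.mem_Icc] at h
    ext
    · rfl
    · simp only; omega
  · rintro ⟨j, i⟩ h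
    simp only [Finset.mem_sigma, Finset.mem_range, Finset.mem_Icc] at h
    have : i + (j + 1 - i) - 1 = j := by omega
    simp [this]
  · rintro ⟨i, l⟩ h
    simp only [Finset.mem_filter, Finset.mem_product, Finset.mem_Icc] at h
    congr 1
    simp only
    omega

/-- The partial sum `∑_{j=1}^{n} A_j / λ^j` of the expansion of `f`. -/
noncomputable def partialExp (θ : ℝ → E d) (lam : ℝ) (n : ℕ) (t : ℝ) : E d :=
  ∑ j ∈ Finset.Icc 1 n, (1 / lam ^ j) • A θ j t

/-- The part of the product `(θᵀ g) g`, for `g` the partial sum of order `n`, that is of order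
at least `n + 2` in `1 / λ`. -/
noncomputable def highOrderPart (θ : ℝ → E d) (lam : ℝ) (n : ℕ) (t : ℝ) : E d :=
  ∑ p ∈ (Finset.Icc 1 n ×ˢ Finset.Icc 1 n).filter (fun p => n + 2 ≤ p.1 + p.2),
    (1 / lam ^ (p.1 + p.2)) • inner ℝ (θ t) (A θ p.2 t) • A θ p.1 t

/-- The partial sum satisfies the equation for `f`, with `coth ρ` replaced by its limit `1`, up to
the term in `A_{n+1}`, of order `1 / λ^n`, and terms of order `1 / λ^(n+1)`. -/
theorem ddt_add_sum_ddt {lam : ℝ} (hlam : lam ≠ 0) (n : ℕ) {t : ℝ} (ht : ‖θ t‖ = 1) :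
    ddt θ t + ∑ j ∈ Finset.Icc 1 n, (1 / lam ^ j) • ddt (A θ j) t =
      -lam • (act (P θ t) (partialExp θ lam n t) +
        inner ℝ (θ t) (partialExp θ lam n t) • partialExp θ lam n t +
        (1 / lam ^ (n + 1)) • act (P θ t) (A θ (n + 1) t) - highOrderPart θ lam n t) := by
  have hsq : inner ℝ (θ t) (partialExp θ lam n t) • partialExp θ lam n t =
      ∑ j ∈ Finset.range (n + 1), ∑ i ∈ Finset.Icc 1 j,
        (1 / lam ^ (i + (j + 1 - i))) • inner ℝ (θ t) (A θ (j + 1 - i) t) • A θ i t +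
      highOrderPart θ lam n t := by
    rw [highOrderPart, ← sum_square_eq_sum_triangle_add
      (fun i l => (1 / lam ^ (i + l)) • inner ℝ (θ t) (A θ l t) • A θ i t) n, partialExp,
      Finset.smul_sum]
    refine Finset.sum_congr rfl fun i _ => ?_
    rw [inner_sum, Finset.sum_smul]
    refine Finset.sum_congr rfl fun l _ => ?_
    rw [inner_smul_right, smul_smul, smul_smul, pow_add]
    congr 1
    field_simp
  have hP : act (P θ t) (partialExp θ lam n t) + (1 / lam ^ (n + 1)) • act (P θ t) (A θ (n + 1) t) =
      ∑ j ∈ Finset.range (n + 1), (1 / lam ^ (j + 1)) • act (P θ t) (A θ (j + 1) t) := by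
    rw [Finset.sum_range_succ]
    congr 1
    simp only [partialExp, act]
    rw [map_sum, Finset.range_eq_Ico,
      Finset.sum_Ico_add' (fun j => (1 / lam ^ j) • (Matrix.toEuclideanLin (P θ t)) (A θ j t))]
    exact Finset.sum_congr (by ext; simp only [Finset.mem_Icc, Finset.mem_Ico]; omega)
      fun j _ => by rw [map_smul]
  have hL : ddt θ t + ∑ j ∈ Finset.Icc 1 n, (1 / lam ^ j) • ddt (A θ j) t =
      ∑ j ∈ Finset.range (n + 1), (1 / lam ^ j) • ddt (A θ j) t := by
    rw [Finset.sum_range_succ', A_zero, add_comm]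
    congr 1
    · rw [Finset.range_eq_Ico, Finset.sum_Ico_add' (fun j => (1 / lam ^ j) • ddt (A θ j) t)]
      exact Finset.sum_congr (by ext; simp only [Finset.mem_Icc, Finset.mem_Ico]; omega) fun j _ => rfl
    · simp
  rw [hsq, hL, show ∀ a b c e : E d, a + (b + e) + c - e = (a + c) + b from fun a b c e => by abel,
    hP, ← Finset.sum_add_distrib, Finset.smul_sum]
  refine Finset.sum_congr rfl fun j _ => ?_
  have h1 : ∑ i ∈ Finset.Icc 1 j,
      (1 / lam ^ (i + (j + 1 - i))) • inner ℝ (θ t) (A θ (j + 1 - i) t) • A θ i t =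
      (1 / lam ^ (j + 1)) • ∑ i ∈ Finset.Icc 1 j, inner ℝ (θ t) (A θ (j + 1 - i) t) • A θ i t := by
    rw [Finset.smul_sum]
    refine Finset.sum_congr rfl fun i hi => ?_
    rw [Finset.mem_Icc] at hi
    rw [show i + (j + 1 - i) = j + 1 by omega]
  rw [h1, ddt_A j ht, act_P, ← smul_add, smul_smul,
    show -lam * (1 / lam ^ (j + 1)) = -(1 / lam ^ j) by
      rw [pow_succ]; field_simp]
  module

theorem norm_partialExp_le {lam M : ℝ} (hlam : 1 ≤ lam) {n : ℕ} {t : ℝ}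
    (hM : ∀ j ∈ Finset.Icc 1 n, ‖A θ j t‖ ≤ M) : ‖partialExp θ lam n t‖ ≤ n * M / lam := by
  have h0 : 0 < lam := by linarith
  refine (norm_sum_le_of_le _ (f := fun j => (1 / lam ^ j) • A θ j t) (n := fun _ => M / lam)
    fun j hj => ?_).trans (by simp [mul_div_assoc])
  rw [norm_smul, Real.norm_eq_abs, abs_of_pos (by positivity), div_mul_eq_mul_div, one_mul]
  have hj1 := (Finset.mem_Icc.1 hj).1
  have hM0 := (norm_nonneg _).trans (hM j hj)
  exact div_le_div₀ hM0 (hM j hj) h0 (le_self_pow₀ hlam (by omega))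

theorem norm_highOrderPart_le {lam M : ℝ} (hlam : 1 ≤ lam) {n : ℕ} {t : ℝ} (ht : ‖θ t‖ = 1)
    (hM : ∀ j ∈ Finset.Icc 1 n, ‖A θ j t‖ ≤ M) :
    ‖highOrderPart θ lam n t‖ ≤ (n * M) ^ 2 / lam ^ (n + 2) := by
  have h0 : 0 < lam := by linarith
  refine (norm_sum_le_of_le _ (n := fun _ => M ^ 2 / lam ^ (n + 2)) fun p hp => ?_).trans ?_
  · simp only [Finset.mem_filter, Finset.mem_product] at hp
    rw [norm_smul, norm_smul, Real.norm_eq_abs, abs_of_pos (by positivity), div_mul_eq_mul_div,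
      one_mul]
    have h1 : ‖inner ℝ (θ t) (A θ p.2 t)‖ ≤ M := by
      refine (norm_inner_le_norm _ _).trans ?_
      rw [ht, one_mul]
      exact hM _ hp.1.2
    have hM0 := (norm_nonneg _).trans h1
    refine div_le_div₀ (by positivity) ?_ (by positivity) (pow_le_pow_right₀ hlam hp.2)
    rw [sq]
    exact mul_le_mul h1 (hM _ hp.1.1) (norm_nonneg _) hM0
  · rw [Finset.sum_const, nsmul_eq_mul, mul_pow, mul_div_assoc]
    refine mul_le_mul_of_nonneg_right ?_ (by positivity)
    have := Finset.card_filter_le (Finset.Icc 1 n ×ˢ Finset.Icc 1 n)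
      (fun p => n + 2 ≤ p.1 + p.2)
    rw [Finset.card_product, Nat.card_Icc, Nat.add_sub_cancel] at this
    rw [sq]
    exact_mod_cast this

end Coefficients

/-! ### Convergence of the rescaled remainder -/

section Remainder

variable {d k : ℕ} {θ : ℝ → E d}

/-- A solution of `u' = -λ ((I + θ θᵀ) u + h)` forgets its initial value at rate `e^{-λ t}`, and is
then as small as the perturbation `h`. -/
theorem norm_sq_le_of_relaxation {u h : ℝ → E d} {lam ε a b : ℝ} (hab : a ≤ b) (hlam : 0 ≤ lam)
    (hu : ContinuousOn u (Icc a b))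
    (hd : ∀ s ∈ Ioo a b, HasDerivAt u (-lam • (act (P θ s) (u s) + h s)) s)
    (hh : ∀ s ∈ Ioo a b, ‖h s‖ ≤ 5 * ε + ‖u s‖ / 4) :
    ‖u b‖ ^ 2 ≤ 50 * ε ^ 2 + ‖u a‖ ^ 2 * Real.exp (-lam * (b - a)) := by
  have key := scalar_decay (q := fun s => ‖u s‖ ^ 2) (c := lam) (m := 50 * ε ^ 2) hab
    (hu.norm.pow 2) (fun s hs => (hd s hs).norm_sq) (fun s hs => by
      rw [act_P, inner_smul_right, inner_add_right, inner_add_right, real_inner_self_eq_norm_sq,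
        inner_smul_right, real_inner_comm (θ s) (u s)]
      have h1 := (abs_le.1 (abs_real_inner_le_norm (u s) (h s))).1
      have h2 := mul_le_mul_of_nonneg_left (hh s hs) (norm_nonneg (u s))
      set p := inner ℝ (θ s) (u s)
      set r := ‖u s‖
      -- Young's inequality `10 ε r ≤ r² / 2 + 50 ε²` absorbs the constant part of the bound on `h`.
      have h3 : r ^ 2 - 50 * ε ^ 2 ≤ 2 * (r ^ 2 + p * p + inner ℝ (u s) (h s)) := by
        nlinarith [sq_nonneg (r - 10 * ε), mul_self_nonneg p]
      have h4 := mul_le_mul_of_nonneg_left h3 hlam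
      linarith)
  have h0 : 0 ≤ 50 * ε ^ 2 * Real.exp (-lam * (b - a)) := by positivity
  have h1 : ‖u b‖ ^ 2 ≤ 50 * ε ^ 2 + (‖u a‖ ^ 2 - 50 * ε ^ 2) * Real.exp (-lam * (b - a)) := by
    linarith
  linarith

theorem coth_sub_one_le_exp_neg {ρ : ℝ} (hρ : 1 ≤ ρ) :
    0 ≤ Real.cosh ρ / Real.sinh ρ - 1 ∧ Real.cosh ρ / Real.sinh ρ - 1 ≤ Real.exp (-ρ) := by
  have h1 : 1 ≤ Real.sinh ρ := hρ.trans (Real.self_le_sinh_iff.2 (by linarith))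
  have h2 : Real.cosh ρ / Real.sinh ρ - 1 = Real.exp (-ρ) / Real.sinh ρ := by
    rw [← Real.cosh_sub_sinh]
    field_simp
  rw [h2]
  exact ⟨by positivity, div_le_self (Real.exp_pos _).le h1⟩

namespace SolvesSystem

variable {lam : ℝ} {f : ℝ → E d} {ρ : ℝ → ℝ}

/-- The radius grows at speed `λ (1 + θᵀ f) ≥ λ / 2`. -/
theorem half_mul_le_radius (hθ : ∀ t ∈ Icc (0 : ℝ) 1, ‖θ t‖ = 1) (hlam : 0 ≤ lam)
    (h : SolvesSystem θ lam f ρ) (hf : ∀ t ∈ Icc (0 : ℝ) 1, ‖f t‖ ≤ 1 / 2) {t : ℝ}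
    (ht : t ∈ Icc (0 : ℝ) 1) : lam / 2 * t ≤ ρ t := by
  have key := scalar_decay (q := fun s => lam / 2 * s - ρ s)
    (q' := fun s => lam / 2 * 1 - lam * (1 + inner ℝ (θ s) (f s))) (c := 0) (m := 0) ht.1
    (ContinuousOn.mono (by
      exact (by fun_prop : Continuous fun s : ℝ => lam / 2 * s).continuousOn.sub h.2.2.2.1)
      (Icc_subset_Icc_right ht.2))
    (fun s hs => by
      have hs1 : s < 1 := hs.2.trans_le ht.2
      exact ((hasDerivAt_id s).const_mul (lam / 2)).sub
        ((h.2.2.2.2 s ⟨hs.1, hs1.le⟩).2.2.hasDerivAt (Icc_mem_nhds hs.1 hs1)))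
    (fun s hs => by
      have hs' : s ∈ Icc (0 : ℝ) 1 := ⟨hs.1.le, hs.2.le.trans ht.2⟩
      have h1 := (abs_le.1 (abs_real_inner_le_norm (θ s) (f s))).1
      rw [hθ s hs', one_mul] at h1
      have := hf s hs'
      nlinarith)
  simp only [h.2.1] at key
  norm_num at key
  linarith

/-- The differential equation of the remainder `f - g`, rescaled by `λ^(n+1)` and compared with a
constant vector `b`. -/
theorem hasDerivAt_rescaled_sub (hlam : lam ≠ 0) (hθ : ∀ t ∈ Icc (0 : ℝ) 1, ‖θ t‖ = 1)
    {n : ℕ} (hA : ∀ j ∈ Finset.Icc 1 n, DifferentiableOn ℝ (A θ j) (Icc 0 1))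
    (h : SolvesSystem θ lam f ρ) (b : E d) {s : ℝ} (hs : s ∈ Ioo (0 : ℝ) 1) :
    HasDerivAt (fun s => lam ^ (n + 1) • (f s - partialExp θ lam n s) - b)
      (-lam • (act (P θ s) (lam ^ (n + 1) • (f s - partialExp θ lam n s) - b) +
        (act (P θ s) (b - A θ (n + 1) s) +
          inner ℝ (θ s) (f s) • lam ^ (n + 1) • (f s - partialExp θ lam n s) +
          inner ℝ (θ s) (lam ^ (n + 1) • (f s - partialExp θ lam n s)) • partialExp θ lam n s +
          lam ^ (n + 1) • highOrderPart θ lam n s +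
          (lam ^ (n + 1) * (Real.cosh (ρ s) / Real.sinh (ρ s) - 1)) •
            act (P θ s + outer (f s) (θ s)) (f s)))) s := by
  have hI := Icc_mem_nhds hs.1 hs.2
  have hg : HasDerivAt (partialExp θ lam n)
      (∑ j ∈ Finset.Icc 1 n, (1 / lam ^ j) • ddt (A θ j) s) s := by
    refine HasDerivAt.fun_sum fun j hj => ?_
    have hAj : HasDerivAt (A θ j) (ddt (A θ j) s) s :=
      ((hA j hj) s (Ioo_subset_Icc_self hs)).hasDerivWithinAt.hasDerivAt hI
    exact hAj.const_smul (1 / lam ^ j)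
  have hf := (h.2.2.2.2 s (Ioo_subset_Ioc_self hs)).2.1.hasDerivAt hI
  refine (((hf.sub hg).const_smul (lam ^ (n + 1))).sub_const b).congr_deriv ?_
  have hexp := ddt_add_sum_ddt hlam n (hθ s (Ioo_subset_Icc_self hs))
  rw [show ∀ a b c : E d, a - b - c = a - (b + c) from fun a b c => by abel, hexp]
  simp only [act_add, act_P, act_outer, inner_sub_right, inner_smul_right]
  match_scalars <;> field_simp <;> ring

end SolvesSystem

theorem tendsto_const_mul_pow_mul_exp_neg (C : ℝ) (m : ℕ) {c : ℝ} (hc : 0 < c) :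
    Tendsto (fun x : ℝ => C * (x ^ m * Real.exp (-c * x))) atTop (𝓝 0) := by
  have h := (tendsto_rpow_mul_exp_neg_mul_atTop_nhds_zero m c hc).const_mul C
  simpa using h

/-- For large `λ` the rescaled remainder relaxes towards `A_{n+1}` at rate `λ`. The boundary layer
at `t = 0`, where the partial sum misses the initial value and `coth ρ` is unbounded, contributes
only exponentially small terms. -/
theorem tendsto_rescaled_sub (hθk : ContDiffOn ℝ k θ (Icc 0 1))
    (hθ : ∀ t ∈ Icc (0 : ℝ) 1, ‖θ t‖ = 1)
    (hθd : ∀ t ∈ Icc (0 : ℝ) 1, HasDerivWithinAt θ (ddt θ t) (Icc 0 1) t)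
    {K : ℝ} (hK : ∀ t ∈ Icc (0 : ℝ) 1, ‖ddt θ t‖ ≤ K)
    {f : ℝ → ℝ → E d} {ρ : ℝ → ℝ → ℝ}
    (h : ∀ᶠ lam in atTop, SolvesSystem θ lam (f lam) (ρ lam))
    {n : ℕ} (hn : n < k) {t : ℝ} (ht : t ∈ Ioc (0 : ℝ) 1) :
    Tendsto (fun lam : ℝ => lam ^ (n + 1) • (f lam t - partialExp θ lam n t)) atTop
      (𝓝 (A θ (n + 1) t)) := by
  have ht' := Ioc_subset_Icc_self ht
  have hK0 : 0 ≤ K := (norm_nonneg _).trans (hK t ht')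
  have hAc : ∀ j ≤ k, ContinuousOn (A θ j) (Icc 0 1) := fun j hj =>
    (contDiffOn_A hθk hθ j 0 (by omega)).continuousOn
  have hAd : ∀ j ∈ Finset.Icc 1 n, DifferentiableOn ℝ (A θ j) (Icc 0 1) := fun j hj =>
    (contDiffOn_A hθk hθ j 1 (by rw [Finset.mem_Icc] at hj; omega)).differentiableOn (by simp)
  obtain ⟨M, hM⟩ : ∃ M, ∀ s ∈ Icc (0 : ℝ) 1, ∀ j ∈ Finset.Icc 1 n, ‖A θ j s‖ ≤ M := by
    obtain ⟨M, hM⟩ := isCompact_Icc.exists_bound_of_continuousOn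
      (continuousOn_finsetSum (Finset.Icc 1 n) fun j hj =>
        (hAc j (by rw [Finset.mem_Icc] at hj; omega)).norm)
    refine ⟨M, fun s hs j hj => le_trans ?_ ((Real.le_norm_self _).trans (hM s hs))⟩
    exact Finset.single_le_sum (f := fun j => ‖A θ j s‖) (fun _ _ => norm_nonneg _) hj
  set b := A θ (n + 1) t with hb
  rw [Metric.tendsto_nhds]
  intro ε₀ hε₀
  obtain ⟨ε, hε, rfl⟩ : ∃ ε, 0 < ε ∧ ε₀ = 16 * ε := ⟨ε₀ / 16, by positivity, by ring⟩
  obtain ⟨r, hr, hcont⟩ := Metric.continuousWithinAt_iff.1 (hAc (n + 1) (by omega) t ht') ε hε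
  -- On `[δ, t]` the moving target `A_{n+1}` stays within `ε` of its value at `t`.
  obtain ⟨δ, hδ0, hδt, hδr⟩ : ∃ δ, 0 < δ ∧ δ < t ∧ t - δ < r :=
    ⟨max (t / 2) (t - r / 2), lt_max_of_lt_left (by linarith [ht.1]),
      max_lt (by linarith [ht.1]) (by linarith), by
        linarith [le_max_right (t / 2) (t - r / 2)]⟩
  have hnear : ∀ s ∈ Ioo δ t, ‖b - A θ (n + 1) s‖ ≤ ε := by
    intro s hs
    rw [← dist_eq_norm, dist_comm]
    refine (hcont ⟨(hδ0.trans hs.1).le, hs.2.le.trans ht.2⟩ ?_).le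
    rw [Real.dist_eq, abs_sub_comm, abs_of_pos (by linarith [hs.2])]
    linarith [hs.1]
  have hdiv : ∀ c η : ℝ, 0 < η → ∀ᶠ lam : ℝ in atTop, c / lam ≤ η := fun c η hη =>
    (tendsto_const_nhds.div_atTop tendsto_id).eventually_le_const hη
  filter_upwards [h, eventually_ge_atTop 1, eventually_gt_atTop K,
    hdiv (2 * K + n * M) (1 / 4) (by norm_num), hdiv ((2 * K + n * M) * ‖b‖) ε hε,
    hdiv ((n * M) ^ 2) ε hε, hdiv (2 * K) (1 / 2) (by norm_num),
    eventually_ge_atTop (2 / δ),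
    (tendsto_const_mul_pow_mul_exp_neg 2 (n + 1) (half_pos hδ0)).eventually_le_const hε,
    (tendsto_const_mul_pow_mul_exp_neg ((1 + ‖b‖) ^ 2) (2 * (n + 1))
      (sub_pos.2 hδt)).eventually_le_const (pow_pos hε 2)]
    with lam hsol hlam1 hlamK hC hCb hQ hKl hlδ hexp hinit
  have hl : 0 < lam := by linarith
  have hfb : ∀ s ∈ Icc (0 : ℝ) 1, ‖f lam s‖ ≤ 2 * K / lam := fun s hs =>
    hsol.norm_le hK hθ hθd hlamK hs
  have hgb : ∀ s ∈ Icc (0 : ℝ) 1, ‖partialExp θ lam n s‖ ≤ n * M / lam := fun s hs =>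
    norm_partialExp_le hlam1 (hM s hs)
  have hsum : ∀ s ∈ Icc (0 : ℝ) 1, ‖f lam s‖ + ‖partialExp θ lam n s‖ ≤
      (2 * K + n * M) / lam := fun s hs => by
    rw [add_div]; exact add_le_add (hfb s hs) (hgb s hs)
  -- The deviation from the limit is relaxed on `[δ, t]`; its perturbation splits into five terms, the
  -- bounds of which add up to `5 ε + ‖u‖ / 4`.
  set u := fun s => lam ^ (n + 1) • (f lam s - partialExp θ lam n s) - b with hu
  have hsub : Icc δ t ⊆ Icc (0 : ℝ) 1 := Icc_subset_Icc hδ0.le ht.2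
  have huc : ContinuousOn u (Icc δ t) := by
    have hg : ContinuousOn (partialExp θ lam n) (Icc 0 1) :=
      continuousOn_finsetSum _ fun j hj => (hAd j hj).continuousOn.const_smul (1 / lam ^ j)
    exact (((hsol.2.2.1.sub hg).const_smul (lam ^ (n + 1))).sub continuousOn_const).mono hsub
  have hIoo : ∀ s ∈ Ioo δ t, s ∈ Ioo (0 : ℝ) 1 := fun s hs =>
    ⟨hδ0.trans hs.1, hs.2.trans_le ht.2⟩
  have key := norm_sq_le_of_relaxation (ε := ε) hδt.le hl.le huc
    (fun s hs => hsol.hasDerivAt_rescaled_sub hl.ne' hθ hAd b (hIoo s hs)) (fun s hs => by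
      have hs' := Ioo_subset_Icc_self (hIoo s hs)
      have hin : ∀ v : E d, |inner ℝ (θ s) v| ≤ ‖v‖ := fun v => by
        simpa [hθ s hs'] using abs_real_inner_le_norm (θ s) v
      have h1 : ‖act (P θ s) (b - A θ (n + 1) s)‖ ≤ 2 * ε := by
        rw [act_P]
        refine (norm_add_le _ _).trans ?_
        rw [norm_smul, hθ s hs', mul_one, Real.norm_eq_abs]
        linarith [hin (b - A θ (n + 1) s), hnear s hs]
      set R := lam ^ (n + 1) • (f lam s - partialExp θ lam n s) with hR
      have hRu : ‖R‖ ≤ ‖u s‖ + ‖b‖ := by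
        have : R = u s + b := by rw [hu]; simp [hR]
        rw [this]; exact norm_add_le _ _
      have h2 : ‖inner ℝ (θ s) (f lam s) • R‖ ≤ ‖f lam s‖ * ‖R‖ := by
        rw [norm_smul]
        exact mul_le_mul_of_nonneg_right (hin _) (norm_nonneg _)
      have h3 : ‖inner ℝ (θ s) R • partialExp θ lam n s‖ ≤ ‖partialExp θ lam n s‖ * ‖R‖ := by
        rw [norm_smul, mul_comm]
        exact mul_le_mul_of_nonneg_left (hin _) (norm_nonneg _)
      have h23 : ‖f lam s‖ * ‖R‖ + ‖partialExp θ lam n s‖ * ‖R‖ ≤ ‖u s‖ / 4 + ε := by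
        rw [← add_mul]
        have hC0 : 0 ≤ (2 * K + n * M) / lam := (by positivity : (0 : ℝ) ≤ _ + _).trans (hsum s hs')
        calc _ ≤ (2 * K + n * M) / lam * (‖u s‖ + ‖b‖) :=
              mul_le_mul (hsum s hs') hRu (norm_nonneg _) hC0
          _ = (2 * K + n * M) / lam * ‖u s‖ + (2 * K + n * M) * ‖b‖ / lam := by ring
          _ ≤ 1 / 4 * ‖u s‖ + ε :=
              add_le_add (mul_le_mul_of_nonneg_right hC (norm_nonneg _)) hCb
          _ = _ := by ring
      have h4 : ‖lam ^ (n + 1) • highOrderPart θ lam n s‖ ≤ ε := by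
        rw [norm_smul, Real.norm_eq_abs, abs_of_pos (by positivity)]
        refine (mul_le_mul_of_nonneg_left
          (norm_highOrderPart_le hlam1 (hθ s hs') (hM s hs')) (by positivity)).trans ?_
        rw [show lam ^ (n + 1) * ((n * M) ^ 2 / lam ^ (n + 2)) = (n * M) ^ 2 / lam by
          rw [pow_succ lam (n + 1)]; field_simp]
        exact hQ
      have h5 : ‖(lam ^ (n + 1) * (Real.cosh (ρ lam s) / Real.sinh (ρ lam s) - 1)) •
          act (P θ s + outer (f lam s) (θ s)) (f lam s)‖ ≤ ε := by
        have hρ : lam / 2 * s ≤ ρ lam s :=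
          hsol.half_mul_le_radius hθ hl.le (fun s hs => (hfb s hs).trans hKl) hs'
        have hδl : 1 ≤ lam / 2 * δ := by
          rw [div_le_iff₀ hδ0] at hlδ
          linarith
        have hρδ : lam / 2 * δ ≤ ρ lam s :=
          (mul_le_mul_of_nonneg_left hs.1.le (by positivity)).trans hρ
        obtain ⟨hc0, hc1⟩ := coth_sub_one_le_exp_neg (hδl.trans hρδ)
        have hη := hsol.norm_add_eq_one hθ hθd (Ioo_subset_Ioc_self (hIoo s hs))
        have hact : ‖act (P θ s + outer (f lam s) (θ s)) (f lam s)‖ ≤ 2 := by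
          rw [SolvesSystem.act_rhs (hθ s hs')]
          refine (norm_sub_le _ _).trans ?_
          rw [norm_smul, hη, hθ s hs', mul_one, Real.norm_eq_abs]
          linarith [hin (θ s + f lam s)]
        rw [norm_smul, Real.norm_eq_abs, abs_of_nonneg (by positivity)]
        calc _ ≤ lam ^ (n + 1) * Real.exp (-(δ / 2) * lam) * 2 := by
              refine mul_le_mul (mul_le_mul_of_nonneg_left (hc1.trans (Real.exp_le_exp.2 ?_))
                (by positivity)) hact (norm_nonneg _) (by positivity)
              linarith
          _ ≤ ε := by linarith
      refine (norm_add_le _ _).trans ((add_le_add_left (norm_add_le _ _) _).trans ?_)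
      have h6 := norm_add₃_le (a := act (P θ s) (b - A θ (n + 1) s))
        (b := inner ℝ (θ s) (f lam s) • R) (c := inner ℝ (θ s) R • partialExp θ lam n s)
      linarith)
  have hδ' : δ ∈ Icc (0 : ℝ) 1 := hsub (left_mem_Icc.2 hδt.le)
  -- The initial value at `δ` may be as large as a power of `λ`, but is damped by `e^{-λ (t - δ)}`.
  have hu0 : ‖u δ‖ ≤ (1 + ‖b‖) * lam ^ (n + 1) := by
    have hL : 1 ≤ lam ^ (n + 1) := one_le_pow₀ hlam1
    refine (norm_sub_le _ _).trans ?_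
    rw [norm_smul, Real.norm_eq_abs, abs_of_pos (by positivity)]
    have h1 : ‖f lam δ - partialExp θ lam n δ‖ ≤ 1 :=
      (norm_sub_le _ _).trans ((hsum δ hδ').trans (hC.trans (by norm_num)))
    nlinarith [norm_nonneg b]
  have hu1 : ‖u δ‖ ^ 2 * Real.exp (-lam * (t - δ)) ≤ ε ^ 2 := by
    refine le_trans ?_ hinit
    rw [← mul_assoc, show -lam * (t - δ) = -(t - δ) * lam by ring]
    refine mul_le_mul_of_nonneg_right ?_ (Real.exp_pos _).le
    rw [mul_comm 2 (n + 1), pow_mul, ← mul_pow]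
    exact pow_le_pow_left₀ (norm_nonneg _) hu0 2
  rw [dist_eq_norm]
  refine lt_of_pow_lt_pow_left₀ 2 (by positivity) (lt_of_le_of_lt (key.trans ?_)
    (by nlinarith [pow_pos hε 2] : 51 * ε ^ 2 < (16 * ε) ^ 2))
  linarith

end Remainder

/-! ### Paths at natural parametrization -/

/-- The speed is `1` almost everywhere, hence everywhere by continuity. -/
theorem norm_ddt_eq_one {d : ℕ} {γ : ℝ → E d} (hγ : ContinuousOn (ddt γ) (Icc 0 1))
    (hnat : IsNaturallyParametrized γ) (hlen : pathLength γ = 1) :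
    ∀ t ∈ Icc (0 : ℝ) 1, ‖ddt γ t‖ = 1 := by
  refine Measure.eqOn_Icc_of_ae_eq volume zero_ne_one (f := fun t => ‖ddt γ t‖)
    (g := fun _ => 1) ?_ hγ.norm continuousOn_const
  filter_upwards [hnat.2, ae_restrict_mem measurableSet_Icc] with t ⟨v, hv, hv1⟩ ht
  rw [ddt, hv.derivWithin (uniqueDiffOn_Icc zero_lt_one t ht), hv1, hlen, ENNReal.toReal_one]

end PathDev

theorem mainTheorem4 (d k : ℕ) (hk : 1 ≤ k) (γ : ℝ → PathDev.E d)
    (hγ : ContDiffOn ℝ ((k + 1 : ℕ) : WithTop ℕ∞) γ (Icc 0 1))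
    (hnat : PathDev.IsNaturallyParametrized γ)
    (hlen : PathDev.pathLength γ = 1)
    (θ : ℝ → PathDev.E d) (hθ : θ = PathDev.ddt γ) :
    -- for large `lam` the development exists in polar coordinates, `η - θ` solves the system,
    -- and the system has no other solution
    (∃ lam₀ : ℝ, 0 < lam₀ ∧ ∀ lam : ℝ, lam₀ ≤ lam →
      (∃ (η : ℝ → PathDev.E d) (ρ : ℝ → ℝ), PathDev.IsHyperbolicDevelopment (lam • γ) η ρ) ∧
      (∀ (η : ℝ → PathDev.E d) (ρ : ℝ → ℝ), PathDev.IsHyperbolicDevelopment (lam • γ) η ρ →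
        PathDev.SolvesSystem θ lam (η - θ) ρ) ∧
      (∀ (f g : ℝ → PathDev.E d) (ρ σ : ℝ → ℝ),
        PathDev.SolvesSystem θ lam f ρ → PathDev.SolvesSystem θ lam g σ →
          EqOn f g (Icc 0 1) ∧ EqOn ρ σ (Icc 0 1))) ∧
    -- the limits
    (∀ (f : ℝ → ℝ → PathDev.E d) (ρ : ℝ → ℝ → ℝ),
      (∀ᶠ lam in atTop, PathDev.SolvesSystem θ lam (f lam) (ρ lam)) →
      ∀ n : ℕ, n < k → ∀ t ∈ Ioc (0 : ℝ) 1,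
        Tendsto
          (fun lam : ℝ =>
            lam ^ (n + 1) • (f lam t - ∑ j ∈ Finset.Icc 1 n, (1 / lam ^ j) • PathDev.A θ j t))
          atTop (𝓝 (PathDev.A θ (n + 1) t))) ∧
    -- the asymptotic expansion of `η` in powers of `1 / lam`, with `A 0 = θ`
    (∀ (η : ℝ → ℝ → PathDev.E d) (ρ : ℝ → ℝ → ℝ),
      (∀ᶠ lam in atTop, PathDev.IsHyperbolicDevelopment (lam • γ) (η lam) (ρ lam)) →
      ∀ t ∈ Ioc (0 : ℝ) 1,
        (fun lam : ℝ =>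
          η lam t - ∑ j ∈ Finset.range (k + 1), (1 / lam ^ j) • PathDev.A θ j t)
          =o[atTop] (fun lam : ℝ => 1 / lam ^ k)) := by
  have hU : UniqueDiffOn ℝ (Icc (0 : ℝ) 1) := uniqueDiffOn_Icc zero_lt_one
  have hθk : ContDiffOn ℝ k θ (Icc 0 1) := by
    rw [hθ]
    exact hγ.derivWithin hU (by norm_cast)
  have hunit : ∀ t ∈ Icc (0 : ℝ) 1, ‖θ t‖ = 1 := by
    rw [hθ] at hθk ⊢
    exact PathDev.norm_ddt_eq_one hθk.continuousOn hnat hlen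
  have hθ1 : ContDiffOn ℝ 1 θ (Icc 0 1) := hθk.of_le (by exact_mod_cast hk)
  have hθd : ∀ t ∈ Icc (0 : ℝ) 1, HasDerivWithinAt θ (PathDev.ddt θ t) (Icc 0 1) t := fun t ht =>
    (hθ1.differentiableOn (by simp) t ht).hasDerivWithinAt
  have hθ'c : ContinuousOn (PathDev.ddt θ) (Icc 0 1) :=
    hθ1.continuousOn_derivWithin hU le_rfl
  obtain ⟨K, hK⟩ := isCompact_Icc.exists_bound_of_continuousOn hθ'c
  have hK0 : 0 ≤ K := (norm_nonneg _).trans (hK 0 (by simp))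
  have hβ : ∀ lam : ℝ, ∀ t ∈ Icc (0 : ℝ) 1, PathDev.ddt (lam • γ) t = lam • θ t := by
    intro lam t ht
    rw [hθ]
    exact derivWithin_const_smul lam (hγ.differentiableOn (by simp) t ht)
  have hlim : ∀ (f : ℝ → ℝ → PathDev.E d) (ρ : ℝ → ℝ → ℝ),
      (∀ᶠ lam in atTop, PathDev.SolvesSystem θ lam (f lam) (ρ lam)) →
      ∀ n : ℕ, n < k → ∀ t ∈ Ioc (0 : ℝ) 1,
        Tendsto
          (fun lam : ℝ =>
            lam ^ (n + 1) • (f lam t - ∑ j ∈ Finset.Icc 1 n, (1 / lam ^ j) • PathDev.A θ j t))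
          atTop (𝓝 (PathDev.A θ (n + 1) t)) := fun f ρ h n hn t ht =>
    PathDev.tendsto_rescaled_sub hθk hunit hθd hK h hn ht
  refine ⟨⟨K + 1, by linarith, fun lam hlam => ⟨?_, ?_, ?_⟩⟩, hlim, ?_⟩
  · exact PathDev.exists_isHyperbolicDevelopment (by linarith) (hβ lam) hunit
      hθk.continuousOn
  · exact fun η ρ h => h.solvesSystem hK hunit hθd (by linarith) (hβ lam)
  · exact fun f g ρ σ hf hg => hf.unique (by linarith) hunit hθd hg
  · intro η ρ h t ht
    obtain ⟨n, rfl⟩ : ∃ n, k = n + 1 := ⟨k - 1, by omega⟩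
    have hsol : ∀ᶠ lam in atTop, PathDev.SolvesSystem θ lam (η lam - θ) (ρ lam) := by
      filter_upwards [h, eventually_gt_atTop K] with lam hdev hlam
      exact hdev.solvesSystem hK hunit hθd hlam (hβ lam)
    have h1 := hlim (fun lam => η lam - θ) ρ hsol n n.lt_succ_self t ht
    have h2 := (isBigO_refl (fun lam : ℝ => 1 / lam ^ (n + 1)) atTop).smul_isLittleO
      ((isLittleO_one_iff ℝ).2 (tendsto_sub_nhds_zero_iff.2 h1))
    simp only [smul_eq_mul, mul_one] at h2
    refine h2.congr' ?_ EventuallyEq.rfl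
    filter_upwards [eventually_gt_atTop 0] with lam hlam
    have hsum : ∑ j ∈ Finset.range (n + 1 + 1), (1 / lam ^ j) • PathDev.A θ j t =
        θ t + ∑ j ∈ Finset.Icc 1 n, (1 / lam ^ j) • PathDev.A θ j t +
          (1 / lam ^ (n + 1)) • PathDev.A θ (n + 1) t := by
      rw [Finset.sum_range_succ, Finset.sum_range_succ', PathDev.A_zero, pow_zero, div_one,
        one_smul, add_comm (θ t), Finset.range_eq_Ico,
        Finset.sum_Ico_add' (fun j => (1 / lam ^ j) • PathDev.A θ j t)]
      congr 3
    rw [hsum, smul_sub, smul_smul, one_div_mul_cancel (pow_pos hlam _).ne', one_smul,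
      Pi.sub_apply]
    abel
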